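/- Let $r,s\ge 0$ be integers with $r\le s+1$, let $\alpha_1,\dots,\alpha_r\in\mathbb C$ and $\beta_1,\dots,\beta_s\in\mathbb C\setminus\{0,-1,-2,\dots\}$, and let $y>0$ and $\upsilon,b,c,\lambda\in\mathbb C$ with $\Re(\upsilon)>0$, $\Re(c)>0$, and $\Re(\lambda)>0,\ \Re(b)>0$ (or $\Re(\lambda)<0,\ \Re(b)<0$). Assume moreover the conditions for convergence of the integral below: $\Re(\lambda b)>0$ (automatic for real $\lambda,b$) and, in the case $r=s+1$ with no $\alpha_i$ in $\{0,-1,-2,\dots\}$, $\Re\big(\sum_j\beta_j-\sum_i\alpha_i\big)+2\Re(\upsilon)>0$. Put $$\Theta(k)=\frac{(\alpha_1)_k\cdots(\alpha_r)_k}{(\beta_1)_k\cdots(\beta_s)_k},\qquad \mu_k=\lambda b+ck\qquad(k=0,1,2,\dots),$$ where $(a)_k$ is the Pochhammer symbol, and let ${}_rF_s(\alpha;\beta;z)=\sum_{k\ge0}\Theta(k)z^k/k!$. Then the Fourier cosine transform $$\nabla_C=\int_0^\infty x^{\upsilon-1}e^{-b\lambda\sqrt x}\,{}_rF_s\big(\alpha;\beta;e^{-c\sqrt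 x}\big)\cos(xy)\,dx$$ converges absolutely, so do the integrals $\int_0^\infty x^{\upsilon-1}e^{-\mu_k\sqrt x}\cos(xy)\,dx$ for $k\ge 0$, and $\nabla_C$ is equal to each of the following, where all series converge: $$\sum_{k=0}^\infty\frac{\Theta(k)}{k!}\int_0^\infty x^{\upsilon-1}e^{-\mu_k\sqrt x}\cos(xy)\,dx$$ $$=\frac{2^{4\upsilon-\frac32}}{\pi}\sum_{k=0}^\infty\frac{\Theta(k)}{k!\,\mu_k^{2\upsilon}}\,G^{1,4}_{4,2}\!\left(\frac{64y^2}{\mu_k^4}\,\Big|\,\begin{matrix}\frac{4-2\upsilon}4,\frac{3-2\upsilon}4,\frac{2-2\upsilon}4,\frac{1-2\upsilon}4;-\\ 0;\frac12\end{matrix}\right)$$ $$=\frac{\sqrt y\,2^{4\upsilon}}{\pi}\sum_{k=0}^\infty\frac{\Theta(k)}{k!\,\mu_k^{2\upsilon+1}}\,G^{1,4}_{4,2}\!\left(\frac{64y^2}{\mu_k^4}\,\Big|\,\begin{matrix}\frac{3-2\upsilon}4,\frac{2-2\upsilon}4,\frac{1-2\upsilon}4,\frac{-2\upsilon}4;-\\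 -\frac14;\frac14\end{matrix}\right)$$ $$=\frac{2^{4\upsilon-\frac92}}{\pi y}\sum_{k=0}^\infty\frac{\Theta(k)}{k!\,\mu_k^{2\upsilon-2}}\,G^{1,4}_{4,2}\!\left(\frac{64y^2}{\mu_k^4}\,\Big|\,\begin{matrix}\frac{6-2\upsilon}4,\frac{5-2\upsilon}4,\frac{4-2\upsilon}4,\frac{3-2\upsilon}4;-\\ \frac12;1\end{matrix}\right)$$ $$=\frac{y\,2^{4\upsilon+\frac32}}{\pi}\sum_{k=0}^\infty\frac{\Theta(k)}{k!\,\mu_k^{2\upsilon+2}}\,G^{1,4}_{4,2}\!\left(\frac{64y^2}{\mu_k^4}\,\Big|\,\begin{matrix}\frac{2-2\upsilon}4,\frac{1-2\upsilon}4,\frac{-2\upsilon}4,\frac{-1-2\upsilon}4;-\\ -\frac12;0\end{matrix}\right)$$ $$=\frac{2^{6\upsilon-\frac72}}{\pi^3}\sum_{k=0}^\infty\frac{\Theta(k)}{k!\,\mu_k^{2\upsilon}}\,G^{2,8}_{8,4}\!\left(\frac{4^8y^4}{\mu_k^8}\,\Big|\,\begin{matrix}\frac{8-2\upsilon}8,\frac{7-2\upsilon}8,\frac{6-2\upsilon}8,\frac{5-2\upsilon}8,\frac{4-2\upsilon}8,\frac{3-2\upsilon}8,\frac{2-2\upsilon}8,\frac{1-2\upsilon}8;-\\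 0,\frac12;\frac14,\frac34\end{matrix}\right).$$ Here powers of $\mu_k$ are principal powers ($\Re\mu_k>0$), and $$G^{m,n}_{p,q}\!\left(z\,\Big|\,\begin{matrix}a_1,\dots,a_n;a_{n+1},\dots,a_p\\ b_1,\dots,b_m;b_{m+1},\dots,b_q\end{matrix}\right)=\frac1{2\pi i}\int_L\frac{\prod_{j=1}^m\Gamma(b_j-\zeta)\prod_{j=1}^n\Gamma(1-a_j+\zeta)}{\prod_{j=m+1}^q\Gamma(1-b_j+\zeta)\prod_{j=n+1}^p\Gamma(a_j-\zeta)}\,z^\zeta\,d\zeta$$ is the Meijer $G$-function, with $L$ any upward vertical line that has the poles of the $\Gamma(b_j-\zeta)$ on its right and those of the $\Gamma(1-a_j+\zeta)$ on its left; such lines exist for the parameters above, and the integrals converge absolutely. Its arguments are taken with $\arg(64y^2/\mu_k^4)=-4\arg\mu_k\in(-2\pi,2\pi)$ and $\arg(4^8y^4/\mu_k^8)=-8\arg\mu_k\in(-4\pi,4\pi)$, where $\arg\mu_k\in(-\frac\pi2,\frac\pi2)$. -/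

import Mathlib

open Complex

noncomputable section

/-- The quotient `(α₁)ₖ ⋯ (αᵣ)ₖ / ((β₁)ₖ ⋯ (βₛ)ₖ)` of Pochhammer symbols (rising factorials). -/
def pochhammerQuotient {r s : ℕ} (α : Fin r → ℂ) (β : Fin s → ℂ) (k : ℕ) : ℂ :=
  (∏ i, (ascPochhammer ℂ k).eval (α i)) / ∏ j, (ascPochhammer ℂ k).eval (β j)

/-- The generalized hypergeometric function `ᵣFₛ(α; β; z)`, as the sum of its power series. -/
def genHypergeometric {r s : ℕ} (α : Fin r → ℂ) (β : Fin s → ℂ) (z : ℂ) : ℂ :=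
  ∑' k : ℕ, pochhammerQuotient α β k * (z ^ k / (k.factorial : ℂ))

/-- The integrand `x^(υ-1) e^(-bλ√x) ᵣFₛ(α; β; e^(-c√x)) cos (xy)`. -/
def nablaIntegrand {r s : ℕ} (α : Fin r → ℂ) (β : Fin s → ℂ) (υ b c lam : ℂ) (y x : ℝ) : ℂ :=
  (x : ℂ) ^ (υ - 1) * exp (-(b * lam * (√x : ℝ))) *
    genHypergeometric α β (exp (-(c * (√x : ℝ)))) * (Real.cos (x * y) : ℝ)

/-- The Fourier cosine transform `∇_C(υ, b, c, λ, y)` of `x^(υ-1) e^(-bλ√x) ᵣFₛ(α; β; e^(-c√x))`. -/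
def nablaC {r s : ℕ} (α : Fin r → ℂ) (β : Fin s → ℂ) (υ b c lam : ℂ) (y : ℝ) : ℂ :=
  ∫ x in Set.Ioi (0 : ℝ), nablaIntegrand α β υ b c lam y x

/-- The integrand of the Mellin-Barnes integral of the Meijer function `G^{m,n}_{p,q}(z)`. Here
`a` lists the upper parameters `a₁, …, aₙ`, `a'` the upper parameters `aₙ₊₁, …, aₚ`, `b` the lower
parameters `b₁, …, bₘ` and `b'` the lower parameters `bₘ₊₁, …, b_q`. The argument `z ≠ 0` lives on
the Riemann surface of the logarithm and is given by its logarithm `w = log |z| + i arg z`, so that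
`z ^ ζ = exp (ζ w)`: the sector `|arg z| < π (m + n - (p + q) / 2)` of convergence may exceed the
range `(-π, π]` of the principal argument. (`Complex.Gamma` is `0` at the poles of `Γ`, so the
reciprocals in the denominator have their correct value `0` there.) -/
def meijerIntegrand {n n' m m' : ℕ} (a : Fin n → ℂ) (a' : Fin n' → ℂ) (b : Fin m → ℂ)
    (b' : Fin m' → ℂ) (w ζ : ℂ) : ℂ :=
  ((∏ j, Gamma (b j - ζ)) * ∏ j, Gamma (1 - a j + ζ)) /
    ((∏ j, Gamma (1 - b' j + ζ)) * ∏ j, Gamma (a' j - ζ)) * exp (ζ * w)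

/-- The upward vertical line `Re ζ = γ` separates the poles `b j + l` of the `Γ(b j - ζ)`, which
are to lie to its right, from the poles `a j - 1 - l` of the `Γ(1 - a j + ζ)`, which are to lie to
its left. -/
def SeparatesPoles {n m : ℕ} (a : Fin n → ℂ) (b : Fin m → ℂ) (γ : ℝ) : Prop :=
  (∀ (j : Fin m) (l : ℕ), γ < (b j + l).re) ∧ ∀ (j : Fin n) (l : ℕ), (a j - 1 - l).re < γ

/-- `IsMeijerG a a' b b' w g`: the Meijer function `G^{m,n}_{p,q}` with these parameters (for which
the two families of poles can be separated by a vertical line) has the value `g` at the point with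
logarithm `w`. That is, there are vertical lines that separate the poles, and along every one of
them `1 / (2πi)` times the contour integral converges absolutely and has the value `g`. -/
def IsMeijerG {n n' m m' : ℕ} (a : Fin n → ℂ) (a' : Fin n' → ℂ) (b : Fin m → ℂ)
    (b' : Fin m' → ℂ) (w g : ℂ) : Prop :=
  (∃ γ : ℝ, SeparatesPoles a b γ) ∧
  ∀ γ : ℝ, SeparatesPoles a b γ →
    MeasureTheory.Integrable (fun t : ℝ => meijerIntegrand a a' b b' w (γ + t * I)) ∧
    1 / (2 * Real.pi * I) * ∫ t : ℝ, meijerIntegrand a a' b b' w (γ + t * I) * I = g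

theorem IsMeijerG.unique {n n' m m' : ℕ} {a : Fin n → ℂ} {a' : Fin n' → ℂ} {b : Fin m → ℂ}
    {b' : Fin m' → ℂ} {w g h : ℂ} (hg : IsMeijerG a a' b b' w g) (hh : IsMeijerG a a' b b' w h) :
    g = h := by
  obtain ⟨⟨γ, hγ⟩, H⟩ := hg
  exact (H γ hγ).2.symm.trans (hh.2 γ hγ).2

end

/-! ### Laplace integrals for complex `p` with positive real part, and decay of Γ on vertical lines
-/

section Laplace

open MeasureTheory Set Filter Topology

/-! Expanding the hypergeometric series in powers of `exp (-c√x)` turns the integrand into a series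
of terms `x^(υ-1) exp (-μₖ√x) cos (xy)` with coefficients `Θ(k)/k!`. Dropping the cosine bounds the
`k`-th absolute integral by a multiple of `(Re μₖ)^(-2 Re υ)`, hence of `(k+1)^(-2 Re υ)`. Euler's
limit for Γ gives the size of `Θ(k)/k!`, and the product is summable
(`summable_integral_norm_cosTransform`), so sum and integral may be exchanged.

Each single integral is found by Mellin-Barnes. Write `exp (-px)` as an inverse Mellin integral of
`Γ(w) p^(-w)`, integrate against `x^(υ-1) exp (-μ√x)`, and get a contour integral of `Γ(w) p^(-w)
Γ(2υ-2w) μ^(2w-2υ)` for `Re p > 0`. The second Γ-factor decays fast enough, as `|arg μ| < π/2`, to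
let `p` tend to `± iy`; averaging the two limits gives the cosine (`integral_cosTransform`).

Put `w = -dζ`, up to a shift of `ζ`. The reflection formula and repeated duplication turn this
kernel into a Meijer integrand: `d = 2` gives `G^{1,4}_{4,2}`, `d = 4` gives `G^{2,8}_{8,4}`. Adding
`κ` to all parameters multiplies `G` by the `κ`-th power of its argument, which accounts for the
four forms with `d = 2`. -/

theorem norm_cpow_mul_exp_neg_mul {a p : ℂ} {x : ℝ} (hx : 0 < x) (u : ℝ) :
    ‖(x : ℂ) ^ a * exp (-(p * u))‖ = x ^ a.re * Real.exp (-p.re * u) := by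
  rw [norm_mul, norm_cpow_eq_rpow_re_of_pos hx, norm_exp]
  simp

theorem aestronglyMeasurable_cpow_Ioi (a : ℂ) :
    AEStronglyMeasurable (fun x : ℝ => (x : ℂ) ^ a) (volume.restrict (Ioi 0)) := by
  refine ContinuousOn.aestronglyMeasurable (fun x hx => ?_) measurableSet_Ioi
  exact (continuousAt_ofReal_cpow_const x a (Or.inr (ne_of_gt hx))).continuousWithinAt

theorem integrableOn_cpow_mul_exp_neg_mul {a p : ℂ} (ha : 0 < a.re) (hp : 0 < p.re) :
    IntegrableOn (fun t : ℝ => (t : ℂ) ^ (a - 1) * exp (-(p * t))) (Ioi 0) := by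
  have h := integrableOn_rpow_mul_exp_neg_mul_rpow (p := 1) (s := a.re - 1) (b := p.re)
    (by linarith) one_pos hp
  refine Integrable.mono' h ((aestronglyMeasurable_cpow_Ioi _).mul
    (by fun_prop)) ?_
  filter_upwards [ae_restrict_mem measurableSet_Ioi] with t ht
  rw [norm_cpow_mul_exp_neg_mul ht]
  simp

theorem hasDerivAt_integral_cpow_mul_exp_neg_mul {a p : ℂ} (ha : 0 < a.re) (hp : 0 < p.re) :
    HasDerivAt (fun q : ℂ => ∫ t in Ioi (0 : ℝ), (t : ℂ) ^ (a - 1) * exp (-(q * t)))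
      (∫ t in Ioi (0 : ℝ), (t : ℂ) ^ (a - 1) * (exp (-(p * t)) * -t)) p := by
  -- On this neighbourhood the derivative is dominated by `t^(Re a) exp (-(Re p / 2) t)`: the factor
  -- `-t` raises the exponent `Re a - 1` by one.
  have hs : {q : ℂ | p.re / 2 < q.re} ∈ 𝓝 p :=
    (isOpen_lt continuous_const continuous_re).mem_nhds (by show p.re / 2 < p.re; linarith)
  have hb := integrableOn_rpow_mul_exp_neg_mul_rpow (p := 1) (s := a.re) (b := p.re / 2)
    (by linarith) one_pos (by linarith)
  refine (hasDerivAt_integral_of_dominated_loc_of_deriv_le (μ := volume.restrict (Ioi (0 : ℝ)))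
    (F := fun q (t : ℝ) => (t : ℂ) ^ (a - 1) * exp (-(q * t)))
    (F' := fun q (t : ℝ) => (t : ℂ) ^ (a - 1) * (exp (-(q * t)) * -t))
    hs (Eventually.of_forall fun q => ?_) (integrableOn_cpow_mul_exp_neg_mul ha hp)
    ?_ ?_ hb ?_).2
  · exact (aestronglyMeasurable_cpow_Ioi _).mul (by fun_prop)
  · exact (aestronglyMeasurable_cpow_Ioi _).mul (by fun_prop)
  · filter_upwards [ae_restrict_mem measurableSet_Ioi] with t ht q hq
    have ht' : 0 < t := ht
    rw [← mul_assoc, norm_mul, norm_cpow_mul_exp_neg_mul ht, norm_neg, norm_real,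
      Real.norm_of_nonneg ht'.le, mul_right_comm, sub_re, one_re, Real.rpow_sub_one ht'.ne',
      div_mul_cancel₀ _ ht'.ne']
    have hq' : p.re / 2 < q.re := hq
    rw [Real.rpow_one]
    gcongr
  · filter_upwards with t q hq
    refine HasDerivAt.const_mul _ (HasDerivAt.cexp ?_)
    exact (hasDerivAt_mul_const (t : ℂ)).neg

/-- Identity theorem: both sides are analytic in `p` on the right half-plane and agree at the real
points `1 + 1/(n+1)`, which accumulate at `1`. -/
theorem integral_cpow_mul_exp_neg_mul_Ioi_of_re_pos {a p : ℂ} (ha : 0 < a.re) (hp : 0 < p.re) :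
    ∫ t in Ioi (0 : ℝ), (t : ℂ) ^ (a - 1) * exp (-(p * t)) = Gamma a * p ^ (-a) := by
  have hopen : IsOpen {q : ℂ | 0 < q.re} := isOpen_lt continuous_const continuous_re
  have h1 : AnalyticOnNhd ℂ
      (fun q : ℂ => ∫ t in Ioi (0 : ℝ), (t : ℂ) ^ (a - 1) * exp (-(q * t))) {q | 0 < q.re} :=
    DifferentiableOn.analyticOnNhd (fun q hq =>
      (hasDerivAt_integral_cpow_mul_exp_neg_mul ha hq).differentiableAt.differentiableWithinAt)
      hopen
  have h2 : AnalyticOnNhd ℂ (fun q : ℂ => Gamma a * q ^ (-a)) {q | 0 < q.re} :=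
    DifferentiableOn.analyticOnNhd (fun q hq => DifferentiableAt.differentiableWithinAt
      ((differentiableAt_id.cpow_const (Or.inl hq)).const_mul _)) hopen
  have hconv : IsPreconnected {q : ℂ | 0 < q.re} := (convex_halfSpace_re_gt 0).isPreconnected
  refine h1.eqOn_of_preconnected_of_frequently_eq h2 hconv (z₀ := 1) (by simp) ?_ hp
  have hlim : Tendsto (fun n : ℕ => ((1 + 1 / ((n : ℝ) + 1) : ℝ) : ℂ)) atTop (𝓝[≠] 1) := by
    refine tendsto_nhdsWithin_of_tendsto_nhds_of_eventually_within _ ?_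
      (Eventually.of_forall fun n => ?_)
    · rw [← ofReal_one, ← add_zero (1 : ℝ)]
      refine (continuous_ofReal.tendsto _).comp ?_
      simpa using tendsto_const_nhds.add (tendsto_one_div_add_atTop_nhds_zero_nat (𝕜 := ℝ))
    · have : (0 : ℝ) < 1 / ((n : ℝ) + 1) := by positivity
      simp only [mem_compl_iff, mem_singleton_iff]
      exact_mod_cast (by linarith : (1 + 1 / ((n : ℝ) + 1)) ≠ 1)
  refine hlim.frequently (Eventually.of_forall fun n => ?_).frequently
  have hpos : (0 : ℝ) < 1 + 1 / ((n : ℝ) + 1) := by positivity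
  rw [integral_cpow_mul_exp_neg_mul_Ioi ha hpos, one_div, inv_cpow _ _
    (by rw [arg_ofReal_of_nonneg hpos.le]; exact Real.pi_pos.ne), cpow_neg, mul_comm]

theorem mellinConvergent_exp_neg_mul {a p : ℂ} (ha : 0 < a.re) (hp : 0 < p.re) :
    MellinConvergent (fun t : ℝ => exp (-(p * t))) a :=
  integrableOn_cpow_mul_exp_neg_mul ha hp

theorem mellin_exp_neg_mul {a p : ℂ} (ha : 0 < a.re) (hp : 0 < p.re) :
    mellin (fun t : ℝ => exp (-(p * t))) a = Gamma a * p ^ (-a) :=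
  integral_cpow_mul_exp_neg_mul_Ioi_of_re_pos ha hp

theorem integrableOn_cpow_mul_exp_neg_mul_sqrt {a p : ℂ} (ha : 0 < a.re) (hp : 0 < p.re) :
    IntegrableOn (fun t : ℝ => (t : ℂ) ^ (a - 1) * exp (-(p * (√t : ℝ)))) (Ioi 0) := by
  have h := (MellinConvergent.comp_rpow (f := fun t : ℝ => exp (-(p * t))) (s := a) (a := 1 / 2)
    (by norm_num)).2 (mellinConvergent_exp_neg_mul (by simpa using ha) hp)
  simpa only [MellinConvergent, ← Real.sqrt_eq_rpow, smul_eq_mul] using h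

theorem integral_cpow_mul_exp_neg_mul_sqrt {a p : ℂ} (ha : 0 < a.re) (hp : 0 < p.re) :
    ∫ t in Ioi (0 : ℝ), (t : ℂ) ^ (a - 1) * exp (-(p * (√t : ℝ))) =
      2 * (Gamma (2 * a) * p ^ (-(2 * a))) := by
  have h := mellin_comp_rpow (fun t : ℝ => exp (-(p * t))) a (1 / 2)
  have e : a / ((1 / 2 : ℝ) : ℂ) = 2 * a := by push_cast; ring
  rw [e, mellin_exp_neg_mul (by simpa using ha) hp] at h
  simp only [mellin, ← Real.sqrt_eq_rpow, smul_eq_mul] at h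
  simpa only [one_div, abs_inv, abs_two, inv_inv, real_smul, ofReal_ofNat] using h

/-- Bound on vertical lines: `Γ(w) p^(-w)` is bounded by its value at `Re w`, `Re p`. -/
theorem norm_Gamma_mul_cpow_neg_le {w p : ℂ} (hw : 0 < w.re) (hp : 0 < p.re) :
    ‖Gamma w * p ^ (-w)‖ ≤ Real.Gamma w.re * p.re ^ (-w.re) := by
  rw [← integral_cpow_mul_exp_neg_mul_Ioi_of_re_pos hw hp]
  refine (norm_integral_le_integral_norm _).trans (le_of_eq ?_)
  have h := integral_rpow_mul_exp_neg_mul_rpow (p := 1) (q := w.re - 1) (b := p.re) one_pos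
    (by linarith) hp
  simp only [Real.rpow_one, sub_add_cancel, div_one, mul_one] at h
  rw [mul_comm, ← h]
  refine setIntegral_congr_fun measurableSet_Ioi fun t ht => ?_
  simpa using norm_cpow_mul_exp_neg_mul (a := w - 1) (p := p) ht t

/-- Exponential decay of `Γ` on vertical lines. -/
theorem norm_Gamma_le_exp_neg {w : ℂ} (hw : 0 < w.re) {θ : ℝ} (hθ : |θ| < Real.pi / 2) :
    ‖Gamma w‖ ≤ Real.Gamma w.re * Real.cos θ ^ (-w.re) * Real.exp (-(θ * w.im)) := by
  obtain ⟨h1, h2⟩ := abs_lt.1 hθ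
  have hre : (exp (θ * I)).re = Real.cos θ := exp_ofReal_mul_I_re θ
  have harg : arg (exp (θ * I)) = θ := by
    rw [exp_mul_I]
    exact arg_cos_add_sin_mul_I ⟨by linarith [Real.pi_pos], by linarith [Real.pi_pos]⟩
  -- For `p = exp (iθ)` the modulus of `p^(-w)` is exactly `exp (θ Im w)`.
  have h := norm_Gamma_mul_cpow_neg_le hw (p := exp (θ * I))
    (by rw [hre]; exact Real.cos_pos_of_mem_Ioo ⟨h1, h2⟩)
  rw [norm_mul, norm_cpow_of_ne_zero (exp_ne_zero _), norm_exp_ofReal_mul_I, Real.one_rpow,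
    harg, hre, neg_im, one_div, ← Real.exp_neg, mul_neg, neg_neg] at h
  rw [Real.exp_neg, ← div_eq_mul_inv, le_div_iff₀ (Real.exp_pos _)]
  exact h

theorem norm_Gamma_le_exp_neg_abs {w : ℂ} (hw : 0 < w.re) {θ : ℝ} (h0 : 0 ≤ θ)
    (hθ : θ < Real.pi / 2) :
    ‖Gamma w‖ ≤ Real.Gamma w.re * Real.cos θ ^ (-w.re) * Real.exp (-(θ * |w.im|)) := by
  rcases abs_choice w.im with h | h <;> rw [h]
  · exact norm_Gamma_le_exp_neg hw (by rwa [abs_of_nonneg h0])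
  · simpa using norm_Gamma_le_exp_neg hw (θ := -θ) (by rwa [abs_neg, abs_of_nonneg h0])

theorem norm_cpow_neg_le_exp_abs {p : ℂ} (hp : p ≠ 0) (w : ℂ) {φ : ℝ} (hφ : |arg p| ≤ φ) :
    ‖p ^ (-w)‖ ≤ ‖p‖ ^ (-w.re) * Real.exp (φ * |w.im|) := by
  rw [norm_cpow_of_ne_zero hp, div_eq_mul_inv, ← Real.exp_neg, neg_re, neg_im]
  gcongr
  calc -(arg p * -w.im) ≤ |arg p * w.im| := by rw [mul_neg, neg_neg]; exact le_abs_self _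
    _ ≤ φ * |w.im| := by rw [abs_mul]; gcongr

theorem integrable_exp_neg_mul_abs {δ : ℝ} (hδ : 0 < δ) :
    Integrable fun t : ℝ => Real.exp (-(δ * |t|)) := by
  rw [← integrableOn_univ, ← Iic_union_Ioi (a := (0 : ℝ)), integrableOn_union]
  refine ⟨(integrableOn_exp_mul_Iic hδ 0).congr_fun (fun t ht => ?_) measurableSet_Iic,
    (integrableOn_exp_mul_Ioi (neg_lt_zero.2 hδ) 0).congr_fun (fun t ht => ?_) measurableSet_Ioi⟩
  · simp [abs_of_nonpos (mem_Iic.1 ht)]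
  · simp [abs_of_pos (mem_Ioi.1 ht)]

end Laplace

/-! ### Mellin-Barnes integral for the cosine transform of `x^(υ-1) exp (-μ√x)` -/

section CosTransform

open MeasureTheory Set Filter Topology

theorem continuous_Gamma_line {σ : ℝ} (hσ : 0 < σ) :
    Continuous fun t : ℝ => Gamma (σ + t * I) := by
  refine continuous_iff_continuousAt.2 fun t => ?_
  have h : ContinuousAt Gamma (σ + t * I) := by
    refine (differentiableAt_Gamma _ fun m hm => ?_).continuousAt
    have := congrArg re hm
    simp only [add_re, ofReal_re, mul_re, I_re, mul_zero, ofReal_im, I_im, mul_one, sub_self,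
      add_zero, neg_re, natCast_re] at this
    have : (0 : ℝ) ≤ m := m.cast_nonneg
    linarith
  exact ContinuousAt.comp (f := fun t : ℝ => (σ + t * I : ℂ)) h (by fun_prop)

theorem continuous_const_cpow_comp {p : ℂ} (hp : p ≠ 0) {f : ℝ → ℂ} (hf : Continuous f) :
    Continuous fun t => p ^ f t :=
  hf.const_cpow (Or.inl hp)

/-- `p^(-w)` grows at most like `exp (|arg p| |t|)`, while Γ decays like `exp (-θ|t|)` for any `θ <
π/2`; any `θ` strictly between `|arg p|` and `π/2` works. -/
theorem integrable_Gamma_mul_cpow_neg {σ : ℝ} (hσ : 0 < σ) {p : ℂ} (hp : 0 < p.re) :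
    Integrable fun t : ℝ => Gamma (σ + t * I) * p ^ (-(σ + t * I)) := by
  have hp0 : p ≠ 0 := by rintro rfl; simp at hp
  have harg : |arg p| < Real.pi / 2 := abs_arg_lt_pi_div_two_iff.2 (Or.inl hp)
  obtain ⟨θ, h1, h2⟩ := exists_between harg
  refine Integrable.mono' ((integrable_exp_neg_mul_abs (sub_pos.2 h1)).const_mul
    (Real.Gamma σ * Real.cos θ ^ (-σ) * ‖p‖ ^ (-σ))) ?_ (Eventually.of_forall fun t => ?_)
  · exact ((continuous_Gamma_line hσ).mul
      (continuous_const_cpow_comp hp0 (by fun_prop))).aestronglyMeasurable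
  · have hre : (σ + t * I : ℂ).re = σ := by simp
    have him : (σ + t * I : ℂ).im = t := by simp
    have e1 := norm_Gamma_le_exp_neg_abs (w := σ + t * I) (by rwa [hre])
      ((abs_nonneg _).trans h1.le) h2
    have e2 := norm_cpow_neg_le_exp_abs hp0 (σ + t * I) le_rfl
    rw [hre, him] at e1 e2
    rw [norm_mul]
    calc _ ≤ _ := mul_le_mul e1 e2 (norm_nonneg _) ((norm_nonneg _).trans e1)
      _ = _ := by
        rw [sub_mul, neg_sub, sub_eq_add_neg, Real.exp_add]
        ring

theorem exp_neg_mul_eq_integral_Gamma {σ : ℝ} (hσ : 0 < σ) {p : ℂ} (hp : 0 < p.re) {x : ℝ}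
    (hx : 0 < x) :
    exp (-(p * x)) = 1 / (2 * Real.pi) * ∫ t : ℝ, (x : ℂ) ^ (-(σ + t * I) : ℂ) *
      (Gamma (σ + t * I) * p ^ (-(σ + t * I) : ℂ)) := by
  have hm : ∀ t : ℝ, mellin (fun t : ℝ => exp (-(p * t))) (σ + t * I) =
      Gamma (σ + t * I) * p ^ (-(σ + t * I) : ℂ) :=
    fun t => mellin_exp_neg_mul (by simpa using hσ) hp
  have h := mellinInv_mellin_eq σ (fun t : ℝ => exp (-(p * t))) hx
    (mellinConvergent_exp_neg_mul (by simpa using hσ) hp)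
    (by simpa only [VerticalIntegrable, hm] using integrable_Gamma_mul_cpow_neg hσ hp)
    (by fun_prop)
  rw [← h, mellinInv]
  simp only [hm, smul_eq_mul, real_smul]
  push_cast
  rfl

/-- The product of the Mellin transforms at `w` of `exp (-p x)` and, up to a factor `2` and the
substitution `w ↦ υ - w`, of `exp (-μ √x)`. -/
noncomputable def expKernel (υ μ p w : ℂ) : ℂ :=
  Gamma w * p ^ (-w) * (Gamma (2 * υ - 2 * w) * μ ^ (-(2 * υ - 2 * w)))

theorem continuous_expKernel_line {υ μ p : ℂ} {σ : ℝ} (hσ : 0 < σ) (hσυ : σ < υ.re) (hμ : μ ≠ 0)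
    (hp : p ≠ 0) : Continuous fun t : ℝ => expKernel υ μ p (σ + t * I) := by
  have h := (continuous_Gamma_line (σ := 2 * υ.re - 2 * σ) (by linarith)).comp
    (f := fun t : ℝ => 2 * υ.im - 2 * t) (by fun_prop)
  have h' : Continuous fun t : ℝ => Gamma (2 * υ - 2 * (σ + t * I)) := by
    refine h.congr fun t => congrArg Gamma ?_
    apply Complex.ext <;> simp
  exact ((continuous_Gamma_line hσ).mul (continuous_const_cpow_comp hp (by fun_prop))).mul
    (h'.mul (continuous_const_cpow_comp hμ (by fun_prop)))

/-- The bound has to be uniform up to the imaginary axis, where `p^(-w)` may cancel the decay of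
`Γ(w)`. The decay comes from `Γ(2υ-2w) μ^(2w-2υ)`, whose argument moves twice as fast as `w`. -/
theorem exists_norm_expKernel_le {υ μ : ℂ} (hμ : 0 < μ.re) {σ : ℝ} (hσ : 0 < σ) (hσυ : σ < υ.re) :
    ∃ C δ : ℝ, 0 ≤ C ∧ 0 < δ ∧ ∀ p : ℂ, p ≠ 0 → 0 ≤ p.re → ∀ t : ℝ,
      ‖expKernel υ μ p (σ + t * I)‖ ≤ C * ‖p‖ ^ (-σ) * Real.exp (-(δ * |t|)) := by
  have hμ0 : μ ≠ 0 := by rintro rfl; simp at hμ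
  have harg : |arg μ| < Real.pi / 2 := abs_arg_lt_pi_div_two_iff.2 (Or.inl hμ)
  -- With `|arg μ| = π/2 - 2δ` and both Γ-factors estimated with `θ = π/2 - δ`, the first pair loses
  -- `δ|t|`, the second gains `δ|Im z| ≥ 2δ|t| - 2δ|Im υ|`.
  set δ := (Real.pi / 2 - |arg μ|) / 2 with hδ
  have hδ0 : 0 < δ := by linarith
  have h0 : 0 ≤ Real.pi / 2 - δ := by linarith [abs_nonneg (arg μ)]
  have h1 : Real.pi / 2 - δ < Real.pi / 2 := by linarith
  set R := 2 * υ.re - 2 * σ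
  have hcos : 0 ≤ Real.cos (Real.pi / 2 - δ) :=
    Real.cos_nonneg_of_mem_Icc ⟨by linarith, by linarith⟩
  have hR : 0 < R := by simp only [R]; linarith
  refine ⟨(Real.Gamma σ * Real.cos (Real.pi / 2 - δ) ^ (-σ)) *
    (Real.Gamma R * Real.cos (Real.pi / 2 - δ) ^ (-R) * ‖μ‖ ^ (-R) *
      Real.exp (2 * δ * |υ.im|)), δ, ?_, hδ0, fun p hp hpre t => ?_⟩
  · have := (Real.Gamma_pos_of_pos hσ).le
    have := (Real.Gamma_pos_of_pos hR).le
    positivity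
  have hre : (σ + t * I : ℂ).re = σ := by simp
  have him : (σ + t * I : ℂ).im = t := by simp
  set z := 2 * υ - 2 * (σ + t * I : ℂ)
  have hzre : z.re = R := by simp [z, R]
  have hzim : z.im = 2 * υ.im - 2 * t := by simp [z]
  have e1 := norm_Gamma_le_exp_neg_abs (w := σ + t * I) (by rwa [hre]) h0 h1
  have e2 := norm_cpow_neg_le_exp_abs hp (σ + t * I)
    (abs_arg_le_pi_div_two_iff.2 hpre)
  have e3 := norm_Gamma_le_exp_neg_abs (w := z) (by rwa [hzre]) h0 h1
  have e4 := norm_cpow_neg_le_exp_abs hμ0 z le_rfl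
  rw [hre, him] at e1 e2
  rw [hzre] at e3 e4
  have hz : 2 * |t| - 2 * |υ.im| ≤ |z.im| := by
    rw [hzim, abs_sub_comm]
    have := abs_sub_abs_le_abs_sub (2 * t) (2 * υ.im)
    rwa [abs_mul, abs_mul, abs_two] at this
  have hexp : Real.exp (-((Real.pi / 2 - δ) * |t|)) * Real.exp (Real.pi / 2 * |t|) *
      (Real.exp (-((Real.pi / 2 - δ) * |z.im|)) * Real.exp (|arg μ| * |z.im|)) ≤
      Real.exp (2 * δ * |υ.im|) * Real.exp (-(δ * |t|)) := by
    simp only [← Real.exp_add]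
    refine Real.exp_le_exp.2 ?_
    have e : |arg μ| = Real.pi / 2 - 2 * δ := by rw [hδ]; ring
    rw [e]
    nlinarith [mul_le_mul_of_nonneg_left hz hδ0.le]
  rw [expKernel, norm_mul, norm_mul, norm_mul]
  calc _ ≤ _ := mul_le_mul
        (mul_le_mul e1 e2 (norm_nonneg _) ((norm_nonneg _).trans e1))
        (mul_le_mul e3 e4 (norm_nonneg _) ((norm_nonneg _).trans e3))
        (by positivity) (mul_nonneg ((norm_nonneg _).trans e1) ((norm_nonneg _).trans e2))
    _ = (Real.Gamma σ * Real.cos (Real.pi / 2 - δ) ^ (-σ)) *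
        (Real.Gamma R * Real.cos (Real.pi / 2 - δ) ^ (-R) * ‖μ‖ ^ (-R)) * ‖p‖ ^ (-σ) *
        (Real.exp (-((Real.pi / 2 - δ) * |t|)) * Real.exp (Real.pi / 2 * |t|) *
        (Real.exp (-((Real.pi / 2 - δ) * |z.im|)) * Real.exp (|arg μ| * |z.im|))) := by ring
    _ ≤ _ := mul_le_mul_of_nonneg_left hexp (by
        have := (Real.Gamma_pos_of_pos hσ).le
        have := (Real.Gamma_pos_of_pos hR).le
        positivity)
    _ = _ := by ring

theorem integrable_expKernel {υ μ p : ℂ} (hμ : 0 < μ.re) {σ : ℝ} (hσ : 0 < σ) (hσυ : σ < υ.re)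
    (hp : p ≠ 0) (hpre : 0 ≤ p.re) : Integrable fun t : ℝ => expKernel υ μ p (σ + t * I) := by
  have hμ0 : μ ≠ 0 := by rintro rfl; simp at hμ
  obtain ⟨C, δ, -, hδ, h⟩ := exists_norm_expKernel_le hμ hσ hσυ
  exact Integrable.mono' ((integrable_exp_neg_mul_abs hδ).const_mul _)
    (continuous_expKernel_line hσ hσυ hμ0 hp).aestronglyMeasurable
    (Eventually.of_forall fun t => h p hp hpre t)

theorem integral_exp_sqrt_mul_exp_of_re_pos {υ μ p : ℂ} (hμ : 0 < μ.re) {σ : ℝ} (hσ : 0 < σ)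
    (hσυ : σ < υ.re) (hp : 0 < p.re) :
    ∫ x in Ioi (0 : ℝ), (x : ℂ) ^ (υ - 1) * exp (-(μ * (√x : ℝ))) * exp (-(p * x)) =
      1 / Real.pi * ∫ t : ℝ, expKernel υ μ p (σ + t * I) := by
  set F : ℝ → ℝ → ℂ := fun x t => (x : ℂ) ^ (υ - (σ + t * I) - 1) * exp (-(μ * (√x : ℝ))) *
    (Gamma (σ + t * I) * p ^ (-(σ + t * I) : ℂ)) with hF
  have hint : Integrable (Function.uncurry F) ((volume.restrict (Ioi 0)).prod volume) := by
    have h1 := (integrableOn_cpow_mul_exp_neg_mul_sqrt (a := υ - σ) (p := μ)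
      (by simpa using hσυ) hμ).mul_prod (integrable_Gamma_mul_cpow_neg hσ hp)
    -- The factor `x^(-it)` has modulus `1`; without it the integrand is a product of an integrable
    -- function of `x` and one of `t`, so Fubini applies.
    have h2 : AEStronglyMeasurable (fun z : ℝ × ℝ => exp (-(z.2 * I * Real.log z.1)))
        ((volume.restrict (Ioi 0)).prod volume) := by
      refine Measurable.aestronglyMeasurable ?_
      fun_prop
    have h3 := h1.bdd_mul h2 (c := 1) (Eventually.of_forall fun z => by
      rw [norm_exp]; simp)
    refine h3.congr ?_
    have hae : ∀ᵐ z : ℝ × ℝ ∂((volume.restrict (Ioi 0)).prod volume), 0 < z.1 :=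
      Measure.quasiMeasurePreserving_fst.ae (ae_restrict_mem measurableSet_Ioi)
    filter_upwards [hae] with z hz
    have hz0 : (z.1 : ℂ) ≠ 0 := ofReal_ne_zero.2 hz.ne'
    have e : υ - (σ + z.2 * I) - 1 = -(z.2 * I) + (υ - σ - 1) := by ring
    simp only [Function.uncurry, hF]
    rw [e, cpow_add _ _ hz0, cpow_def_of_ne_zero hz0 (-(z.2 * I)), ← ofReal_log hz.le]
    ring_nf
  have hswap := integral_integral_swap hint
  have hleft : ∫ x in Ioi (0 : ℝ), ∫ t, F x t = 2 * Real.pi *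
      ∫ x in Ioi (0 : ℝ), (x : ℂ) ^ (υ - 1) * exp (-(μ * (√x : ℝ))) * exp (-(p * x)) := by
    rw [← integral_const_mul]
    refine setIntegral_congr_fun measurableSet_Ioi fun x hx => ?_
    have hx0 : (x : ℂ) ≠ 0 := ofReal_ne_zero.2 (ne_of_gt hx)
    have hpi : (Real.pi : ℂ) ≠ 0 := ofReal_ne_zero.2 Real.pi_ne_zero
    rw [exp_neg_mul_eq_integral_Gamma hσ hp hx]
    have e : ∀ t : ℝ, F x t = (x : ℂ) ^ (υ - 1) * exp (-(μ * (√x : ℝ))) *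
        ((x : ℂ) ^ (-(σ + t * I) : ℂ) * (Gamma (σ + t * I) * p ^ (-(σ + t * I) : ℂ))) := by
      intro t
      simp only [hF]
      rw [show υ - (σ + t * I) - 1 = (υ - 1) + -(σ + t * I) by ring, cpow_add _ _ hx0]
      ring
    simp only [e]
    rw [integral_const_mul, mul_left_comm (2 * (Real.pi : ℂ)), ← mul_assoc (2 * (Real.pi : ℂ)),
      mul_one_div_cancel (mul_ne_zero two_ne_zero hpi), one_mul]
  have hright : ∫ t, ∫ x in Ioi (0 : ℝ), F x t = 2 * ∫ t : ℝ, expKernel υ μ p (σ + t * I) := by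
    rw [← integral_const_mul]
    refine integral_congr_ae (Eventually.of_forall fun t => ?_)
    simp only [hF]
    rw [integral_mul_const, integral_cpow_mul_exp_neg_mul_sqrt (by simpa using hσυ) hμ, expKernel,
      mul_sub]
    ring
  have hpi : (Real.pi : ℂ) ≠ 0 := ofReal_ne_zero.2 Real.pi_ne_zero
  rw [hleft, hright] at hswap
  field_simp
  linear_combination hswap / 2

theorem integrableOn_cpow_mul_exp_sqrt_mul {υ μ : ℂ} (hυ : 0 < υ.re) (hμ : 0 < μ.re) {f : ℝ → ℂ}
    (hf : Measurable f) (hf1 : ∀ x, 0 < x → ‖f x‖ ≤ 1) :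
    IntegrableOn (fun x : ℝ => (x : ℂ) ^ (υ - 1) * exp (-(μ * (√x : ℝ))) * f x) (Ioi 0) := by
  refine (integrableOn_cpow_mul_exp_neg_mul_sqrt hυ hμ).mul_bdd (c := 1)
    hf.aestronglyMeasurable ?_
  filter_upwards [ae_restrict_mem measurableSet_Ioi] with x hx using hf1 x hx

theorem norm_exp_neg_mul_ofReal_le_one {p : ℂ} (hp : 0 ≤ p.re) {x : ℝ} (hx : 0 < x) :
    ‖exp (-(p * x))‖ ≤ 1 := by
  rw [norm_exp, Real.exp_le_one_iff]
  simpa using mul_nonneg hp hx.le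

/-- Apply the case `Re p > 0` to `p = ε + q` and let `ε → 0+`, by dominated convergence on both
sides. The condition `q.im ≠ 0` keeps `q` off the branch cut and `‖ε + q‖` away from `0`. -/
theorem integral_exp_sqrt_mul_exp {υ μ q : ℂ} (hμ : 0 < μ.re) {σ : ℝ} (hσ : 0 < σ)
    (hσυ : σ < υ.re) (hq : 0 ≤ q.re) (hqim : q.im ≠ 0) :
    ∫ x in Ioi (0 : ℝ), (x : ℂ) ^ (υ - 1) * exp (-(μ * (√x : ℝ))) * exp (-(q * x)) =
      1 / Real.pi * ∫ t : ℝ, expKernel υ μ q (σ + t * I) := by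
  have hμ0 : μ ≠ 0 := by rintro rfl; simp at hμ
  have hpne : ∀ ε : ℝ, (ε + q : ℂ) ≠ 0 := fun ε h => hqim (by simpa using congrArg im h)
  have hε : Tendsto (fun ε : ℝ => (ε + q : ℂ)) (𝓝[>] 0) (𝓝 q) := by
    have : Tendsto (fun ε : ℝ => (ε + q : ℂ)) (𝓝 0) (𝓝 (((0 : ℝ) : ℂ) + q)) :=
      Continuous.tendsto (by fun_prop) 0
    simpa using this.mono_left nhdsWithin_le_nhds
  have hmem : ∀ᶠ ε : ℝ in 𝓝[>] 0, 0 < ε := self_mem_nhdsWithin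
  have hL : Tendsto (fun ε : ℝ => ∫ x in Ioi (0 : ℝ),
      (x : ℂ) ^ (υ - 1) * exp (-(μ * (√x : ℝ))) * exp (-((ε + q) * x))) (𝓝[>] 0)
      (𝓝 (∫ x in Ioi (0 : ℝ), (x : ℂ) ^ (υ - 1) * exp (-(μ * (√x : ℝ))) * exp (-(q * x)))) := by
    have hi := integrableOn_cpow_mul_exp_neg_mul_sqrt (a := υ) (p := μ) (hσ.trans hσυ) hμ
    refine tendsto_integral_filter_of_dominated_convergence _
      (Eventually.of_forall fun ε => hi.aestronglyMeasurable.mul (by fun_prop)) ?_ hi.norm ?_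
    · filter_upwards [hmem] with ε hε0
      filter_upwards [ae_restrict_mem measurableSet_Ioi] with x hx
      rw [norm_mul]
      refine mul_le_of_le_one_right (norm_nonneg _)
        (norm_exp_neg_mul_ofReal_le_one ?_ hx)
      simp only [add_re, ofReal_re]
      linarith
    · exact Eventually.of_forall fun x => (Tendsto.cexp (hε.mul_const _).neg).const_mul _
  have hR : Tendsto (fun ε : ℝ => ∫ t : ℝ, expKernel υ μ (ε + q) (σ + t * I)) (𝓝[>] 0)
      (𝓝 (∫ t : ℝ, expKernel υ μ q (σ + t * I))) := by
    obtain ⟨C, δ, hC, hδ, h⟩ := exists_norm_expKernel_le hμ hσ hσυ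
    refine tendsto_integral_filter_of_dominated_convergence
      (fun t => C * |q.im| ^ (-σ) * Real.exp (-(δ * |t|)))
      (Eventually.of_forall fun ε =>
        (continuous_expKernel_line hσ hσυ hμ0 (hpne ε)).aestronglyMeasurable) ?_
      ((integrable_exp_neg_mul_abs hδ).const_mul _) ?_
    · filter_upwards [hmem] with ε hε0
      refine Eventually.of_forall fun t => ?_
      refine (h _ (hpne ε) (by simp only [add_re, ofReal_re]; linarith) t).trans ?_
      gcongr C * ?_ * _
      refine Real.rpow_le_rpow_of_nonpos (abs_pos.2 hqim) ?_ (by linarith)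
      simpa using abs_im_le_norm (ε + q)
    · refine Eventually.of_forall fun t => ?_
      have hc : Tendsto (fun ε : ℝ => (ε + q : ℂ) ^ (-(σ + t * I) : ℂ)) (𝓝[>] 0)
          (𝓝 (q ^ (-(σ + t * I) : ℂ))) :=
        (continuousAt_cpow_const (Or.inr hqim)).tendsto.comp hε
      exact (hc.const_mul _).mul_const _
  refine tendsto_nhds_unique hL ((hR.const_mul _).congr' ?_)
  filter_upwards [hmem] with ε hε0
  exact (integral_exp_sqrt_mul_exp_of_re_pos hμ hσ hσυ
    (by simp only [add_re, ofReal_re]; linarith)).symm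

/-- The integrand of the Mellin-Barnes integral of the cosine transform of
`x ^ (υ - 1) * exp (-μ √x)`. -/
noncomputable def cosKernel (υ μ : ℂ) (y : ℝ) (w : ℂ) : ℂ :=
  Gamma w * cos (Real.pi * w / 2) * (y : ℂ) ^ (-w) *
    (Gamma (2 * υ - 2 * w) * μ ^ (-(2 * υ - 2 * w)))

theorem ofReal_mul_I_cpow {y : ℝ} (hy : 0 < y) (w : ℂ) :
    (y * I) ^ w = (y : ℂ) ^ w * exp (Real.pi * w / 2 * I) := by
  have hy0 : (y : ℂ) ≠ 0 := ofReal_ne_zero.2 hy.ne'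
  rw [cpow_def_of_ne_zero (mul_ne_zero hy0 I_ne_zero), cpow_def_of_ne_zero hy0,
    log_ofReal_mul hy I_ne_zero, log_I, ofReal_log hy.le, ← exp_add]
  ring_nf

theorem ofReal_mul_neg_I_cpow {y : ℝ} (hy : 0 < y) (w : ℂ) :
    (y * -I) ^ w = (y : ℂ) ^ w * exp (-(Real.pi * w / 2) * I) := by
  have hy0 : (y : ℂ) ≠ 0 := ofReal_ne_zero.2 hy.ne'
  rw [cpow_def_of_ne_zero (mul_ne_zero hy0 (neg_ne_zero.2 I_ne_zero)), cpow_def_of_ne_zero hy0,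
    log_ofReal_mul hy (neg_ne_zero.2 I_ne_zero), log_neg_I, ofReal_log hy.le, ← exp_add]
  ring_nf

/-- `(± iy)^(-w) = y^(-w) exp (∓ iπw/2)`, and the mean of the two exponentials is `cos (πw/2)`. -/
theorem cosKernel_eq {υ μ : ℂ} {y : ℝ} (hy : 0 < y) (w : ℂ) :
    cosKernel υ μ y w = (expKernel υ μ (y * I) w + expKernel υ μ (y * -I) w) / 2 := by
  rw [cosKernel, expKernel, expKernel, ofReal_mul_I_cpow hy, ofReal_mul_neg_I_cpow hy,
    show cos (Real.pi * w / 2) = cos (Real.pi * -w / 2) by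
      rw [← cos_neg]; ring_nf, cos]
  ring

theorem integrable_cosKernel {υ μ : ℂ} {y : ℝ} (hy : 0 < y) (hμ : 0 < μ.re) {σ : ℝ} (hσ : 0 < σ)
    (hσυ : σ < υ.re) : Integrable fun t : ℝ => cosKernel υ μ y (σ + t * I) := by
  simp only [cosKernel_eq hy]
  have hy0 : (y : ℂ) ≠ 0 := ofReal_ne_zero.2 hy.ne'
  exact ((integrable_expKernel hμ hσ hσυ (by simp [hy0]) (by simp)).add
    (integrable_expKernel hμ hσ hσυ (by simp [hy0]) (by simp))).div_const 2

theorem integrableOn_cosTransform {υ μ : ℂ} (hυ : 0 < υ.re) (hμ : 0 < μ.re) (y : ℝ) :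
    IntegrableOn (fun x : ℝ => (x : ℂ) ^ (υ - 1) * exp (-(μ * (√x : ℝ))) *
      (Real.cos (x * y) : ℝ)) (Ioi 0) :=
  integrableOn_cpow_mul_exp_sqrt_mul hυ hμ (by fun_prop)
    fun x _ => by rw [norm_real]; exact Real.abs_cos_le_one _

theorem integral_cosTransform {υ μ : ℂ} {y : ℝ} (hy : 0 < y) (hμ : 0 < μ.re) {σ : ℝ}
    (hσ : 0 < σ) (hσυ : σ < υ.re) :
    ∫ x in Ioi (0 : ℝ), (x : ℂ) ^ (υ - 1) * exp (-(μ * (√x : ℝ))) * (Real.cos (x * y) : ℝ) =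
      1 / Real.pi * ∫ t : ℝ, cosKernel υ μ y (σ + t * I) := by
  have hy0 : (y : ℂ) ≠ 0 := ofReal_ne_zero.2 hy.ne'
  have hυ := hσ.trans hσυ
  have hi : ∀ q : ℂ, 0 ≤ q.re → IntegrableOn (fun x : ℝ => (x : ℂ) ^ (υ - 1) *
      exp (-(μ * (√x : ℝ))) * exp (-(q * x))) (Ioi 0) := fun q hq =>
    integrableOn_cpow_mul_exp_sqrt_mul hυ hμ (by fun_prop)
      fun x hx => norm_exp_neg_mul_ofReal_le_one hq hx
  have e : ∀ x : ℝ, (x : ℂ) ^ (υ - 1) * exp (-(μ * (√x : ℝ))) * (Real.cos (x * y) : ℝ) =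
      ((x : ℂ) ^ (υ - 1) * exp (-(μ * (√x : ℝ))) * exp (-(y * I * x)) +
        (x : ℂ) ^ (υ - 1) * exp (-(μ * (√x : ℝ))) * exp (-(y * -I * x))) / 2 := by
    intro x
    rw [ofReal_cos, cos]
    push_cast
    ring_nf
  simp only [e, cosKernel_eq hy, integral_div]
  rw [integral_add (hi _ (by simp)) (hi _ (by simp)),
    integral_add (integrable_expKernel hμ hσ hσυ (by simp [hy0]) (by simp))
      (integrable_expKernel hμ hσ hσυ (by simp [hy0]) (by simp)),
    integral_exp_sqrt_mul_exp hμ hσ hσυ (by simp) (by simpa using hy.ne'),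
    integral_exp_sqrt_mul_exp hμ hσ hσυ (by simp) (by simpa using hy.ne')]
  ring

end CosTransform

/-! ### From the cosine kernel to Meijer integrands, by reflection and duplication of Γ -/

section MeijerG

open MeasureTheory Set Filter Topology

/-- The line `Re ζ = γ` becomes `Re w = d(κ - γ)`, and separation of poles becomes `0 < Re w < Re
υ`. As `integral_cosTransform` holds on every line in that strip, no contour has to be moved. The
constant is `1/(2πi) · i · (1/d) · π = 1/(2d)`. -/
theorem isMeijerG_of_eq_cosKernel {n n' m m' : ℕ} {a : Fin n → ℂ} {a' : Fin n' → ℂ}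
    {b : Fin m → ℂ} {b' : Fin m' → ℂ} {υ μ W D : ℂ} {y κ d : ℝ} (hυ : 0 < υ.re) (hμ : 0 < μ.re)
    (hy : 0 < y) (hd : 0 < d)
    (hsep : ∀ γ, SeparatesPoles a b γ ↔ κ - υ.re / d < γ ∧ γ < κ)
    (hker : ∀ ζ : ℂ, ζ.re < 0 →
      meijerIntegrand a a' b b' W (κ + ζ) = D * cosKernel υ μ y (-(d * ζ))) :
    IsMeijerG a a' b b' W (D / (2 * d) * ∫ x in Ioi (0 : ℝ), (x : ℂ) ^ (υ - 1) *
      exp (-(μ * (√x : ℝ))) * (Real.cos (x * y) : ℝ)) := by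
  constructor
  · obtain ⟨γ, h⟩ := exists_between (show κ - υ.re / d < κ by linarith [div_pos hυ hd])
    exact ⟨γ, (hsep γ).2 h⟩
  intro γ hγ
  obtain ⟨h1, h2⟩ := (hsep γ).1 hγ
  have hσ : 0 < d * (κ - γ) := mul_pos hd (sub_pos.2 h2)
  have hσυ : d * (κ - γ) < υ.re := by
    rw [mul_comm, ← lt_div_iff₀ hd]
    linarith
  have e : ∀ t : ℝ, meijerIntegrand a a' b b' W (γ + t * I) =
      D * cosKernel υ μ y ((d * (κ - γ) : ℝ) + (-d * t : ℝ) * I) := by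
    intro t
    have := hker ((γ - κ) + t * I) (by simpa using h2)
    rw [show (κ : ℂ) + ((γ - κ) + t * I) = γ + t * I by ring] at this
    rw [this]
    congr 2
    push_cast
    ring
  have hi := integrable_cosKernel hy hμ hσ hσυ
  simp only [e]
  refine ⟨(hi.comp_mul_left' (neg_ne_zero.2 hd.ne')).const_mul D, ?_⟩
  rw [integral_mul_const, integral_const_mul, Measure.integral_comp_mul_left
    (fun t : ℝ => cosKernel υ μ y ((d * (κ - γ) : ℝ) + t * I)),
    integral_cosTransform hy hμ hσ hσυ, inv_neg, abs_neg, abs_of_pos (inv_pos.2 hd), real_smul]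
  have hpi : (Real.pi : ℂ) ≠ 0 := ofReal_ne_zero.2 Real.pi_ne_zero
  have hd0 : (d : ℂ) ≠ 0 := ofReal_ne_zero.2 hd.ne'
  generalize (∫ t : ℝ, cosKernel υ μ y ((d * (κ - γ) : ℝ) + t * I)) = J
  push_cast
  field_simp

theorem Gamma_neg_div_Gamma_half_add {ζ : ℂ} (hζ : ζ.re < 1 / 2) :
    Gamma (-ζ) / Gamma (1 / 2 + ζ) =
      2 ^ (1 + 2 * ζ) / (√Real.pi : ℝ) * (Gamma (-(2 * ζ)) * cos (Real.pi * ζ)) := by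
  have hpi : (Real.pi : ℂ) ≠ 0 := ofReal_ne_zero.2 Real.pi_ne_zero
  have hs : ((√Real.pi : ℝ) : ℂ) ≠ 0 := ofReal_ne_zero.2 (Real.sqrt_ne_zero'.2 Real.pi_pos)
  have hs2 : (Real.pi : ℂ) = (√Real.pi : ℝ) * (√Real.pi : ℝ) := by
    rw [← ofReal_mul, Real.mul_self_sqrt Real.pi_pos.le]
  have hG : Gamma (1 / 2 - ζ) ≠ 0 := Gamma_ne_zero_of_re_pos (by simpa using hζ)
  have h1 := Gamma_mul_Gamma_one_sub (1 / 2 + ζ)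
  rw [show 1 - (1 / 2 + ζ) = 1 / 2 - ζ by ring,
    show (Real.pi : ℂ) * (1 / 2 + ζ) = Real.pi * ζ + Real.pi / 2 by ring,
    sin_add_pi_div_two] at h1
  -- Inverting the reflection formula is harmless at the poles of `Γ(1/2 + ζ)`: there `Gamma` is `0`
  -- by convention and `cos (πζ) = 0`.
  have h2 : (Gamma (1 / 2 + ζ))⁻¹ = Gamma (1 / 2 - ζ) * cos (Real.pi * ζ) / Real.pi := by
    have := congrArg (·⁻¹) h1
    simp only [mul_inv, inv_div] at this
    rw [mul_div_assoc, ← this, mul_left_comm, mul_inv_cancel₀ hG, mul_one]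
  have h3 := Gamma_mul_Gamma_add_half (-ζ)
  rw [show -ζ + 1 / 2 = 1 / 2 - ζ by ring, show 2 * -ζ = -(2 * ζ) by ring, sub_neg_eq_add] at h3
  rw [div_eq_mul_inv, h2, mul_div_assoc', ← mul_assoc, h3, hs2]
  field_simp

theorem Gamma_mul_four (z : ℂ) :
    Gamma (z + 3 / 4) * Gamma (z + 2 / 4) * Gamma (z + 1 / 4) * Gamma z =
      (√Real.pi : ℝ) ^ 3 * 2 ^ (5 / 2 - 8 * z) * Gamma (4 * z) := by
  have h1 := Gamma_mul_Gamma_add_half z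
  have h2 := Gamma_mul_Gamma_add_half (z + 1 / 4)
  have h3 := Gamma_mul_Gamma_add_half (2 * z)
  rw [show z + 1 / 4 + 1 / 2 = z + 3 / 4 by ring,
    show 2 * (z + 1 / 4) = 2 * z + 1 / 2 by ring] at h2
  rw [show 2 * (2 * z) = 4 * z by ring] at h3
  have hp : (2 : ℂ) ^ (5 / 2 - 8 * z) =
      2 ^ (1 - 2 * z) * 2 ^ (1 - (2 * z + 1 / 2)) * 2 ^ (1 - 4 * z) := by
    rw [← cpow_add _ _ two_ne_zero, ← cpow_add _ _ two_ne_zero]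
    ring_nf
  rw [show z + 2 / 4 = z + 1 / 2 by ring, hp]
  calc _ = (Gamma z * Gamma (z + 1 / 2)) * (Gamma (z + 1 / 4) * Gamma (z + 3 / 4)) := by ring
    _ = (Gamma (2 * z) * Gamma (2 * z + 1 / 2)) * (2 ^ (1 - 2 * z) * 2 ^ (1 - (2 * z + 1 / 2)) *
        (√Real.pi : ℝ) ^ 2) := by rw [h1, h2]; ring
    _ = _ := by rw [h3]; ring

theorem Gamma_mul_eight (z : ℂ) :
    Gamma (z + 7 / 8) * Gamma (z + 6 / 8) * Gamma (z + 5 / 8) * Gamma (z + 4 / 8) *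
      Gamma (z + 3 / 8) * Gamma (z + 2 / 8) * Gamma (z + 1 / 8) * Gamma z =
      (√Real.pi : ℝ) ^ 7 * 2 ^ (5 - 24 * z) * Gamma (8 * z) := by
  have h1 := Gamma_mul_four z
  have h2 := Gamma_mul_four (z + 1 / 8)
  have h3 := Gamma_mul_Gamma_add_half (4 * z)
  rw [show z + 1 / 8 + 3 / 4 = z + 7 / 8 by ring, show z + 1 / 8 + 2 / 4 = z + 5 / 8 by ring,
    show z + 1 / 8 + 1 / 4 = z + 3 / 8 by ring,
    show 4 * (z + 1 / 8) = 4 * z + 1 / 2 by ring] at h2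
  rw [show 2 * (4 * z) = 8 * z by ring] at h3
  have hp : (2 : ℂ) ^ (5 - 24 * z) =
      2 ^ (5 / 2 - 8 * z) * 2 ^ (5 / 2 - 8 * (z + 1 / 8)) * 2 ^ (1 - 8 * z) := by
    rw [← cpow_add _ _ two_ne_zero, ← cpow_add _ _ two_ne_zero]
    ring_nf
  rw [show z + 6 / 8 = z + 3 / 4 by ring, show z + 4 / 8 = z + 2 / 4 by ring,
    show z + 2 / 8 = z + 1 / 4 by ring, hp]
  calc _ = (Gamma (z + 3 / 4) * Gamma (z + 2 / 4) * Gamma (z + 1 / 4) * Gamma z) *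
        (Gamma (z + 7 / 8) * Gamma (z + 5 / 8) * Gamma (z + 3 / 8) * Gamma (z + 1 / 8)) := by ring
    _ = (Gamma (4 * z) * Gamma (4 * z + 1 / 2)) * (2 ^ (5 / 2 - 8 * z) *
        2 ^ (5 / 2 - 8 * (z + 1 / 8)) * (√Real.pi : ℝ) ^ 6) := by rw [h1, h2]; ring
    _ = _ := by rw [h3]; ring

/-- Duplication in numerator and denominator reduces the quotient for `G^{2,8}_{8,4}` to the one for
`G^{1,4}_{4,2}`, taken at `2ζ`. -/
theorem Gamma_quotient_eq (ζ : ℂ) :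
    Gamma (-ζ) * Gamma (1 / 2 - ζ) / (Gamma (3 / 4 + ζ) * Gamma (1 / 4 + ζ)) =
      2 ^ (1 / 2 + 4 * ζ) * (Gamma (-(2 * ζ)) / Gamma (1 / 2 + 2 * ζ)) := by
  have hs : ((√Real.pi : ℝ) : ℂ) ≠ 0 := ofReal_ne_zero.2 (Real.sqrt_ne_zero'.2 Real.pi_pos)
  have hn := Gamma_mul_Gamma_add_half (-ζ)
  have hd := Gamma_mul_Gamma_add_half (1 / 4 + ζ)
  rw [show 1 / 4 + ζ + 1 / 2 = 3 / 4 + ζ by ring,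
    show 2 * (1 / 4 + ζ) = 1 / 2 + 2 * ζ by ring] at hd
  rw [show 2 * -ζ = -(2 * ζ) by ring] at hn
  have hr : (2 : ℂ) ^ (1 - -(2 * ζ)) = 2 ^ (1 - (1 / 2 + 2 * ζ)) * 2 ^ (1 / 2 + 4 * ζ) := by
    rw [← cpow_add _ _ two_ne_zero]
    ring_nf
  have h2 : (2 : ℂ) ^ (1 - (1 / 2 + 2 * ζ)) ≠ 0 := by simp [cpow_eq_zero_iff]
  rw [show 1 / 2 - ζ = -ζ + 1 / 2 by ring, hn, mul_comm (Gamma (3 / 4 + ζ)), hd, hr]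
  generalize (2 : ℂ) ^ (1 - (1 / 2 + 2 * ζ)) = A at *
  generalize (2 : ℂ) ^ (1 / 2 + 4 * ζ) = B
  generalize ((√Real.pi : ℝ) : ℂ) = C at *
  field_simp

/-- Only the extreme poles matter: `κ` on the right and `(4-2υ)/4 + κ - 1 = κ - υ/2` on the left. -/
theorem separatesPoles_four_iff {υ : ℂ} {κ γ : ℝ} :
    SeparatesPoles ![(4 - 2 * υ) / 4 + κ, (3 - 2 * υ) / 4 + κ, (2 - 2 * υ) / 4 + κ,
      (1 - 2 * υ) / 4 + κ] ![(κ : ℂ)] γ ↔ κ - υ.re / 2 < γ ∧ γ < κ := by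
  constructor
  · rintro ⟨hb, ha⟩
    have h1 := hb 0 0
    have h2 := ha 0 0
    simp at h1 h2
    exact ⟨by linarith, h1⟩
  · rintro ⟨h1, h2⟩
    refine ⟨fun j l => ?_, fun j l => ?_⟩ <;>
    · have : (0 : ℝ) ≤ l := l.cast_nonneg
      fin_cases j <;> simp <;> linarith

theorem separatesPoles_eight_iff {υ : ℂ} {γ : ℝ} :
    SeparatesPoles ![(8 - 2 * υ) / 8, (7 - 2 * υ) / 8, (6 - 2 * υ) / 8, (5 - 2 * υ) / 8,
      (4 - 2 * υ) / 8, (3 - 2 * υ) / 8, (2 - 2 * υ) / 8, (1 - 2 * υ) / 8] ![(0 : ℂ), 1 / 2] γ ↔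
      (0 : ℝ) - υ.re / 4 < γ ∧ γ < 0 := by
  constructor
  · rintro ⟨hb, ha⟩
    have h1 := hb 0 0
    have h2 := ha 0 0
    simp at h1 h2
    exact ⟨by linarith, h1⟩
  · rintro ⟨h1, h2⟩
    refine ⟨fun j l => ?_, fun j l => ?_⟩ <;>
    · have : (0 : ℝ) ≤ l := l.cast_nonneg
      fin_cases j <;> simp <;> linarith

theorem exp_mul_logs {y : ℝ} (hy : 0 < y) {μ : ℂ} (hμ : μ ≠ 0) (k l : ℕ) (q ζ : ℂ) :
    exp (ζ * ((Real.log (2 ^ k * y ^ l) : ℝ) - q * log μ)) =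
      2 ^ (k * ζ) * (y : ℂ) ^ (l * ζ) * μ ^ (-(q * ζ)) := by
  rw [Real.log_mul (by positivity) (by positivity), Real.log_pow, Real.log_pow,
    cpow_def_of_ne_zero two_ne_zero, cpow_def_of_ne_zero (ofReal_ne_zero.2 hy.ne'),
    cpow_def_of_ne_zero hμ, ← exp_add, ← exp_add, ← ofReal_log hy.le, ← ofReal_ofNat 2,
    ← ofReal_log zero_le_two]
  push_cast
  ring_nf

theorem isMeijerG_four {υ μ : ℂ} {y : ℝ} (hυ : 0 < υ.re) (hμ : 0 < μ.re) (hy : 0 < y) (κ : ℝ) :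
    IsMeijerG ![(4 - 2 * υ) / 4 + κ, (3 - 2 * υ) / 4 + κ, (2 - 2 * υ) / 4 + κ,
      (1 - 2 * υ) / 4 + κ] ![] ![(κ : ℂ)] ![1 / 2 + (κ : ℂ)]
      ((Real.log (64 * y ^ 2) : ℝ) - 4 * log μ)
      (Real.pi * 2 ^ (3 / 2 - 4 * υ) * μ ^ (2 * υ) *
        exp (κ * ((Real.log (64 * y ^ 2) : ℝ) - 4 * log μ)) *
        ∫ x in Ioi (0 : ℝ), (x : ℂ) ^ (υ - 1) *
          exp (-(μ * (√x : ℝ))) * (Real.cos (x * y) : ℝ)) := by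
  have hμ0 : μ ≠ 0 := by rintro rfl; simp at hμ
  have hs : ((√Real.pi : ℝ) : ℂ) ≠ 0 := ofReal_ne_zero.2 (Real.sqrt_ne_zero'.2 Real.pi_pos)
  have hs2 : (Real.pi : ℂ) = (√Real.pi : ℝ) * (√Real.pi : ℝ) := by
    rw [← ofReal_mul, Real.mul_self_sqrt Real.pi_pos.le]
  set W : ℂ := (Real.log (64 * y ^ 2) : ℝ) - 4 * log μ with hW
  have h := isMeijerG_of_eq_cosKernel (a' := ![]) (b' := ![1 / 2 + (κ : ℂ)]) (W := W)
    (D := Real.pi * 2 ^ (7 / 2 - 4 * υ) * μ ^ (2 * υ) * exp (κ * W)) (d := 2)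
    hυ hμ hy two_pos (fun γ => separatesPoles_four_iff (υ := υ) (κ := κ)) ?_
  · convert! h using 2
    rw [show (7 / 2 - 4 * υ) = (3 / 2 - 4 * υ) + (2 : ℕ) by push_cast; ring,
      cpow_add _ _ two_ne_zero, cpow_natCast]
    push_cast
    ring
  · intro ζ hζ
    have hexp : exp (ζ * W) = 2 ^ (6 * ζ) * (y : ℂ) ^ (2 * ζ) * μ ^ (-(4 * ζ)) := by
      have := exp_mul_logs hy hμ0 6 2 4 ζ
      norm_num at this
      exact this
    have hG := Gamma_mul_four (υ / 2 + ζ)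
    have hq := Gamma_neg_div_Gamma_half_add (ζ := ζ) (by linarith)
    simp only [meijerIntegrand, cosKernel, Fin.prod_univ_four, Fin.prod_univ_one,
      Fin.prod_univ_zero, Matrix.cons_val, Matrix.cons_val_zero, Matrix.cons_val_one, mul_one]
    rw [show (κ : ℂ) - (κ + ζ) = -ζ by ring,
      show 1 - ((4 - 2 * υ) / 4 + κ) + (κ + ζ) = υ / 2 + ζ by ring,
      show 1 - ((3 - 2 * υ) / 4 + κ) + (κ + ζ) = υ / 2 + ζ + 1 / 4 by ring,
      show 1 - ((2 - 2 * υ) / 4 + κ) + (κ + ζ) = υ / 2 + ζ + 2 / 4 by ring,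
      show 1 - ((1 - 2 * υ) / 4 + κ) + (κ + ζ) = υ / 2 + ζ + 3 / 4 by ring,
      show 1 - (1 / 2 + κ) + (κ + ζ) = 1 / 2 + ζ by ring,
      add_mul, exp_add, hexp]
    -- The constant `64 = 2^6` in the argument is what makes all powers of `2` depending on `ζ`
    -- cancel.
    have hp : (2 : ℂ) ^ (7 / 2 - 4 * υ) =
        2 ^ (5 / 2 - 8 * (υ / 2 + ζ)) * 2 ^ (6 * ζ) * 2 ^ (1 + 2 * ζ) := by
      rw [← cpow_add _ _ two_ne_zero, ← cpow_add _ _ two_ne_zero]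
      ring_nf
    have hm : μ ^ (-(4 * ζ)) = μ ^ (2 * υ) * μ ^ (-(2 * υ - 2 * -(((2 : ℝ) : ℂ) * ζ))) := by
      rw [← cpow_add _ _ hμ0]
      push_cast
      ring_nf
    rw [hp, hm]
    calc _ = Gamma (-ζ) / Gamma (1 / 2 + ζ) * (Gamma (υ / 2 + ζ + 3 / 4) *
          Gamma (υ / 2 + ζ + 2 / 4) * Gamma (υ / 2 + ζ + 1 / 4) * Gamma (υ / 2 + ζ)) *
          (exp (κ * W) * (2 ^ (6 * ζ) * (y : ℂ) ^ (2 * ζ) * (μ ^ (2 * υ) *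
            μ ^ (-(2 * υ - 2 * -(((2 : ℝ) : ℂ) * ζ)))))) := by ring
      _ = _ := by
        rw [hG, hq, show 4 * (υ / 2 + ζ) = 2 * υ - 2 * -(((2 : ℝ) : ℂ) * ζ) by
            push_cast; ring,
          show (Real.pi : ℂ) * -(((2 : ℝ) : ℂ) * ζ) / 2 = -(Real.pi * ζ) by push_cast; ring,
          cos_neg, neg_neg, ofReal_ofNat, hs2]
        field_simp

theorem isMeijerG_eight {υ μ : ℂ} {y : ℝ} (hυ : 0 < υ.re) (hμ : 0 < μ.re) (hy : 0 < y) :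
    IsMeijerG ![(8 - 2 * υ) / 8, (7 - 2 * υ) / 8, (6 - 2 * υ) / 8, (5 - 2 * υ) / 8,
      (4 - 2 * υ) / 8, (3 - 2 * υ) / 8, (2 - 2 * υ) / 8, (1 - 2 * υ) / 8] ![]
      ![(0 : ℂ), 1 / 2] ![1 / 4, 3 / 4]
      ((Real.log (4 ^ 8 * y ^ 4) : ℝ) - 8 * log μ)
      ((Real.pi : ℂ) ^ 3 * 2 ^ (7 / 2 - 6 * υ) * μ ^ (2 * υ) *
        ∫ x in Ioi (0 : ℝ), (x : ℂ) ^ (υ - 1) *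
          exp (-(μ * (√x : ℝ))) * (Real.cos (x * y) : ℝ)) := by
  have hμ0 : μ ≠ 0 := by rintro rfl; simp at hμ
  have hs : ((√Real.pi : ℝ) : ℂ) ≠ 0 := ofReal_ne_zero.2 (Real.sqrt_ne_zero'.2 Real.pi_pos)
  have hs2 : (Real.pi : ℂ) = (√Real.pi : ℝ) * (√Real.pi : ℝ) := by
    rw [← ofReal_mul, Real.mul_self_sqrt Real.pi_pos.le]
  set W : ℂ := (Real.log (4 ^ 8 * y ^ 4) : ℝ) - 8 * log μ with hW
  have h := isMeijerG_of_eq_cosKernel (a' := ![]) (b' := ![1 / 4, 3 / 4]) (W := W)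
    (D := (Real.pi : ℂ) ^ 3 * 2 ^ (13 / 2 - 6 * υ) * μ ^ (2 * υ)) (d := 4) (κ := 0)
    hυ hμ hy four_pos (fun γ => separatesPoles_eight_iff (υ := υ)) ?_
  · convert! h using 2
    rw [show (13 / 2 - 6 * υ) = (7 / 2 - 6 * υ) + (3 : ℕ) by push_cast; ring,
      cpow_add _ _ two_ne_zero, cpow_natCast]
    push_cast
    ring
  · intro ζ hζ
    have hexp : exp (ζ * W) = 2 ^ (16 * ζ) * (y : ℂ) ^ (4 * ζ) * μ ^ (-(8 * ζ)) := by
      have := exp_mul_logs hy hμ0 16 4 8 ζ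
      rw [hW, show (4 : ℝ) ^ 8 = 2 ^ 16 by norm_num]
      exact_mod_cast this
    have hG := Gamma_mul_eight (υ / 4 + ζ)
    have hq := Gamma_neg_div_Gamma_half_add (ζ := 2 * ζ) (by simp; linarith)
    have hr := Gamma_quotient_eq ζ
    simp only [meijerIntegrand, cosKernel, Fin.prod_univ_eight, Fin.prod_univ_two,
      Fin.prod_univ_zero, Matrix.cons_val, Matrix.cons_val_zero, Matrix.cons_val_one, mul_one,
      ofReal_zero, zero_add]
    rw [zero_sub,
      show 1 - (8 - 2 * υ) / 8 + ζ = υ / 4 + ζ by ring,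
      show 1 - (7 - 2 * υ) / 8 + ζ = υ / 4 + ζ + 1 / 8 by ring,
      show 1 - (6 - 2 * υ) / 8 + ζ = υ / 4 + ζ + 2 / 8 by ring,
      show 1 - (5 - 2 * υ) / 8 + ζ = υ / 4 + ζ + 3 / 8 by ring,
      show 1 - (4 - 2 * υ) / 8 + ζ = υ / 4 + ζ + 4 / 8 by ring,
      show 1 - (3 - 2 * υ) / 8 + ζ = υ / 4 + ζ + 5 / 8 by ring,
      show 1 - (2 - 2 * υ) / 8 + ζ = υ / 4 + ζ + 6 / 8 by ring,
      show 1 - (1 - 2 * υ) / 8 + ζ = υ / 4 + ζ + 7 / 8 by ring,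
      show 1 - 1 / 4 + ζ = 3 / 4 + ζ by ring, show 1 - 3 / 4 + ζ = 1 / 4 + ζ by ring, hexp]
    -- Here the cancellation is `-24 + 16 + 4 + 4 = 0`, with `16` coming from `4^8 = 2^16`.
    have hp : (2 : ℂ) ^ (13 / 2 - 6 * υ) = 2 ^ (5 - 24 * (υ / 4 + ζ)) * 2 ^ (16 * ζ) *
        2 ^ (1 + 2 * (2 * ζ)) * 2 ^ (1 / 2 + 4 * ζ) := by
      simp only [← cpow_add _ _ (two_ne_zero (α := ℂ))]
      ring_nf
    have hm : μ ^ (-(8 * ζ)) = μ ^ (2 * υ) * μ ^ (-(2 * υ - 2 * -(((4 : ℝ) : ℂ) * ζ))) := by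
      rw [← cpow_add _ _ hμ0]
      push_cast
      ring_nf
    rw [hp, hm]
    calc _ = Gamma (-ζ) * Gamma (1 / 2 - ζ) / (Gamma (3 / 4 + ζ) * Gamma (1 / 4 + ζ)) *
          (Gamma (υ / 4 + ζ + 7 / 8) * Gamma (υ / 4 + ζ + 6 / 8) * Gamma (υ / 4 + ζ + 5 / 8) *
            Gamma (υ / 4 + ζ + 4 / 8) * Gamma (υ / 4 + ζ + 3 / 8) * Gamma (υ / 4 + ζ + 2 / 8) *
            Gamma (υ / 4 + ζ + 1 / 8) * Gamma (υ / 4 + ζ)) *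
          (2 ^ (16 * ζ) * (y : ℂ) ^ (4 * ζ) * (μ ^ (2 * υ) *
            μ ^ (-(2 * υ - 2 * -(((4 : ℝ) : ℂ) * ζ))))) := by ring
      _ = _ := by
        rw [hr, hG, hq, show 8 * (υ / 4 + ζ) = 2 * υ - 2 * -(((4 : ℝ) : ℂ) * ζ) by
            push_cast; ring,
          show (Real.pi : ℂ) * -(((4 : ℝ) : ℂ) * ζ) / 2 = -(Real.pi * (2 * ζ)) by
            push_cast; ring,
          cos_neg, neg_neg, ofReal_ofNat, show 2 * (2 * ζ) = 4 * ζ by ring, hs2]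
        field_simp

end MeijerG

/-! ### Size of the coefficients and exchange of sum and integral -/

section Series

open MeasureTheory Set Filter Topology Asymptotics

/-- Tonelli: the sum of the norms has finite integral, so the series converges absolutely almost
everywhere and is dominated by that sum. -/
theorem integrable_tsum_of_summable_integral_norm {α : Type*} [MeasurableSpace α] {ν : Measure α}
    {F : ℕ → α → ℂ} (hF : ∀ k, Integrable (F k) ν) (hs : Summable fun k => ∫ a, ‖F k a‖ ∂ν) :
    Integrable (fun a => ∑' k, F k a) ν := by
  have hlint : ∫⁻ a, ∑' k, ‖F k a‖ₑ ∂ν ≠ ⊤ := by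
    rw [lintegral_tsum fun k => (hF k).1.enorm]
    simp_rw [← ofReal_integral_norm_eq_lintegral_enorm (hF _)]
    rw [← ENNReal.ofReal_tsum_of_nonneg (fun k => integral_nonneg fun _ => norm_nonneg _) hs]
    exact ENNReal.ofReal_ne_top
  have hsum : ∀ᵐ a ∂ν, Summable fun k => F k a := by
    have := ae_lt_top' (AEMeasurable.tsum fun k => (hF k).1.enorm) hlint
    filter_upwards [this] with a ha
    refine Summable.of_norm ?_
    have h2 := ENNReal.tsum_coe_ne_top_iff_summable.1
      (show ∑' k, ((‖F k a‖₊ : NNReal) : ENNReal) ≠ ⊤ from ha.ne)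
    exact NNReal.summable_coe.2 h2
  refine ⟨?_, ?_⟩
  · refine aestronglyMeasurable_of_tendsto_ae atTop
      (f := fun n a => ∑ k ∈ Finset.range n, F k a)
      (fun n => Finset.aestronglyMeasurable_fun_sum _ fun k _ => (hF k).1) ?_
    filter_upwards [hsum] with a ha using ha.hasSum.tendsto_sum_nat
  · exact (lintegral_mono fun a => enorm_tsum_le_tsum_enorm).trans_lt hlint.lt_top

theorem ascPochhammer_eval_eq_prod (n : ℕ) (a : ℂ) :
    (ascPochhammer ℂ n).eval a = ∏ j ∈ Finset.range n, (a + j) := by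
  induction n with
  | zero => simp
  | succ n ih => rw [ascPochhammer_succ_eval, ih, Finset.prod_range_succ]

/-- `GammaSeq a n` is `n^a n!` divided by the `n + 1` factors `a, …, a + n`, whence the index `n +
1`. -/
theorem norm_ascPochhammer_succ (a : ℂ) {n : ℕ} (hn : 0 < n) :
    ‖(ascPochhammer ℂ (n + 1)).eval a‖ = (n : ℝ) ^ a.re * n.factorial / ‖GammaSeq a n‖ := by
  have hn' : (0 : ℝ) < n := Nat.cast_pos.2 hn
  have h1 : (n : ℝ) ^ a.re * n.factorial ≠ 0 := by positivity
  rw [GammaSeq, ← ascPochhammer_eval_eq_prod, norm_div, norm_mul, ← ofReal_natCast n,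
    norm_cpow_eq_rpow_re_of_pos hn', norm_natCast, div_div_cancel₀ h1]

theorem norm_pochhammerQuotient_succ {r s d : ℕ} (hd : s + 1 = r + d) (α : Fin r → ℂ)
    (β : Fin s → ℂ) {n : ℕ} (hn : 0 < n) :
    ‖pochhammerQuotient α β (n + 1) / ((n + 1).factorial : ℂ)‖ =
      (∏ j, ‖GammaSeq (β j) n‖) / (∏ i, ‖GammaSeq (α i) n‖) *
        ((n : ℝ) ^ (∑ i, α i - ∑ j, β j).re / ((n + 1) * (n.factorial : ℝ) ^ d)) := by
  have hn' : (0 : ℝ) < n := Nat.cast_pos.2 hn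
  have hf : (n.factorial : ℝ) ≠ 0 := by positivity
  have hpow : (n.factorial : ℝ) ^ s * n.factorial = (n.factorial : ℝ) ^ r * n.factorial ^ d := by
    rw [← pow_succ, hd, pow_add]
  rw [pochhammerQuotient, norm_div, norm_div, norm_prod, norm_prod, norm_natCast,
    Nat.factorial_succ]
  simp only [norm_ascPochhammer_succ _ hn, Finset.prod_div_distrib, Finset.prod_mul_distrib,
    Finset.prod_const, Finset.card_univ, Fintype.card_fin, ← Real.rpow_sum_of_pos hn', sub_re,
    re_sum, Real.rpow_sub hn']
  push_cast
  generalize (n : ℝ) ^ (∑ j, (β j).re) = B at *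
  generalize (n : ℝ) ^ (∑ i, (α i).re) = A at *
  generalize ∏ j, ‖GammaSeq (β j) n‖ = P
  generalize ∏ i, ‖GammaSeq (α i) n‖ = Q
  rw [div_div_div_eq, div_div, div_mul_div_comm]
  calc _ = A * P * (n.factorial ^ r) /
        (Q * B * ((n + 1) * (n.factorial ^ s * n.factorial))) := by ring
    _ = A * P / (Q * B * ((n + 1) * n.factorial ^ d)) := by
      rw [hpow]
      rw [show Q * B * (((n : ℝ) + 1) * ((n.factorial : ℝ) ^ r * n.factorial ^ d)) =
        Q * B * (((n : ℝ) + 1) * n.factorial ^ d) * n.factorial ^ r by ring,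
        mul_div_mul_right _ _ (pow_ne_zero _ hf)]
    _ = _ := by
      generalize ((n : ℝ) + 1) * n.factorial ^ d = E
      ring

theorem summable_rpow_div_factorial (A : ℝ) :
    Summable fun n : ℕ => (n : ℝ) ^ A / n.factorial := by
  obtain ⟨N, hN⟩ := exists_nat_ge A
  refine summable_of_isBigO_nat (Real.summable_pow_div_factorial 2) ?_
  have h := (isLittleO_pow_const_const_pow_of_one_lt (R := ℝ) N one_lt_two).isBigO
  have h2 : (fun n : ℕ => (n : ℝ) ^ A) =O[atTop] fun n : ℕ => (n : ℝ) ^ N := by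
    refine IsBigO.of_bound 1 ?_
    filter_upwards [eventually_ge_atTop 1] with n hn
    have hn' : (1 : ℝ) ≤ n := Nat.one_le_cast.2 hn
    rw [one_mul, Real.norm_of_nonneg (by positivity), Real.norm_of_nonneg (by positivity),
      ← Real.rpow_natCast]
    exact Real.rpow_le_rpow_of_exponent_le hn' hN
  exact (h2.trans h).mul (isBigO_refl (fun n : ℕ => ((n.factorial : ℝ))⁻¹) atTop)

/-- A non-terminating series has terms `O(n^(Re(∑α - ∑β) - 1 - ρ) / n!^d)` with `d = s + 1 - r`. For
`d = 0` the hypothesis puts the exponent below `-1`; for `d ≥ 1` the factorial wins. -/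
theorem summable_pochhammerQuotient_mul_rpow {r s : ℕ} (hrs : r ≤ s + 1) {α : Fin r → ℂ}
    {β : Fin s → ℂ} {ρ : ℝ} (hρ : 0 ≤ ρ)
    (hω : r = s + 1 → (∃ (i : Fin r) (l : ℕ), α i = -(l : ℂ)) ∨
      0 < (∑ j, β j - ∑ i, α i).re + ρ) :
    Summable fun k : ℕ => ‖pochhammerQuotient α β k / (k.factorial : ℂ)‖ *
      ((k : ℝ) + 1) ^ (-ρ) := by
  by_cases hterm : ∃ (i : Fin r) (l : ℕ), α i = -(l : ℂ)
  · obtain ⟨i, l, hil⟩ := hterm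
    refine summable_of_ne_finset_zero (s := Finset.range (l + 1)) fun k hk => ?_
    have hk' : l < k := by
      have := Finset.mem_range.not.1 hk
      omega
    have : pochhammerQuotient α β k = 0 := by
      rw [pochhammerQuotient, Finset.prod_eq_zero (Finset.mem_univ i), zero_div]
      rw [hil, ascPochhammer_eval_neg_coe_nat_of_lt hk']
    simp [this]
  obtain ⟨d, hd⟩ := Nat.exists_eq_add_of_le hrs
  rw [← summable_nat_add_iff 1]
  -- `Gamma` takes the value `0` only at nonpositive integers, excluded here because the series does
  -- not terminate.
  have hα : ∏ i, ‖Gamma (α i)‖ ≠ 0 := by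
    refine Finset.prod_ne_zero_iff.2 fun i _ => norm_ne_zero_iff.2 (Gamma_ne_zero fun m hm => ?_)
    exact hterm ⟨i, m, hm⟩
  have hlim : Tendsto (fun n : ℕ => (∏ j, ‖GammaSeq (β j) n‖) / (∏ i, ‖GammaSeq (α i) n‖)) atTop
      (𝓝 ((∏ j, ‖Gamma (β j)‖) / ∏ i, ‖Gamma (α i)‖)) :=
    (tendsto_finsetProd _ fun j _ => (GammaSeq_tendsto_Gamma (β j)).norm).div
      (tendsto_finsetProd _ fun i _ => (GammaSeq_tendsto_Gamma (α i)).norm) hα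
  have hbig : (fun n : ℕ => ‖pochhammerQuotient α β (n + 1) / ((n + 1).factorial : ℂ)‖ *
      (((n + 1 : ℕ) : ℝ) + 1) ^ (-ρ)) =O[atTop] fun n : ℕ =>
      (n : ℝ) ^ ((∑ i, α i - ∑ j, β j).re - 1 - ρ) / (n.factorial : ℝ) ^ d := by
    have h1 := (hlim.isBigO_one ℝ).mul (isBigO_refl (fun n : ℕ =>
      (n : ℝ) ^ ((∑ i, α i - ∑ j, β j).re - 1 - ρ) / (n.factorial : ℝ) ^ d) atTop)
    simp only [one_mul] at h1
    refine IsBigO.trans (IsBigO.of_bound 1 ?_) h1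
    filter_upwards [eventually_gt_atTop 0] with n hn
    have hn' : (0 : ℝ) < n := Nat.cast_pos.2 hn
    rw [norm_pochhammerQuotient_succ hd α β hn, one_mul, Real.norm_of_nonneg (by positivity),
      Real.norm_of_nonneg (by positivity), mul_assoc]
    refine mul_le_mul_of_nonneg_left ?_ (by positivity)
    rw [Real.rpow_sub hn', Real.rpow_sub hn', Real.rpow_one]
    have h2 : (((n + 1 : ℕ) : ℝ) + 1) ^ (-ρ) ≤ ((n : ℝ) ^ ρ)⁻¹ := by
      rw [← Real.rpow_neg hn'.le]
      refine Real.rpow_le_rpow_of_nonpos hn' ?_ (by linarith)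
      push_cast
      linarith
    calc _ ≤ (n : ℝ) ^ (∑ i, α i - ∑ j, β j).re / (n * (n.factorial : ℝ) ^ d) *
          ((n : ℝ) ^ ρ)⁻¹ := by
          gcongr
          linarith
      _ = _ := by
        rw [div_div, div_div, ← div_eq_mul_inv, div_div]
        ring_nf
  refine summable_of_isBigO_nat ?_ hbig
  rcases Nat.eq_zero_or_pos d with rfl | hd0
  · have hr : r = s + 1 := by omega
    have h := (hω hr).resolve_left hterm
    simp only [pow_zero, div_one]
    refine Real.summable_nat_rpow.2 ?_
    rw [sub_re] at h ⊢
    linarith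
  · refine Summable.of_nonneg_of_le (fun n => by positivity) (fun n => ?_)
      (summable_rpow_div_factorial ((∑ i, α i - ∑ j, β j).re - 1 - ρ))
    gcongr
    exact le_self_pow₀ (by exact_mod_cast n.factorial_pos) hd0.ne'

theorem integral_norm_cosTransform_le {υ μ : ℂ} (hυ : 0 < υ.re) (hμ : 0 < μ.re) (y : ℝ) :
    ∫ x in Ioi (0 : ℝ), ‖(x : ℂ) ^ (υ - 1) * exp (-(μ * (√x : ℝ))) * (Real.cos (x * y) : ℝ)‖ ≤
      2 * Real.Gamma (2 * υ.re) * μ.re ^ (-(2 * υ.re)) := by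
  have h := _root_.integral_rpow_mul_exp_neg_mul_rpow (p := 1 / 2) (q := υ.re - 1) (b := μ.re)
    (by norm_num) (by linarith) hμ
  have hi := integrableOn_rpow_mul_exp_neg_mul_rpow (p := 1 / 2) (s := υ.re - 1) (b := μ.re)
    (by linarith) (by norm_num) hμ
  have e : 2 * Real.Gamma (2 * υ.re) * μ.re ^ (-(2 * υ.re)) =
      ∫ x in Ioi (0 : ℝ), x ^ (υ.re - 1) * Real.exp (-μ.re * x ^ (1 / 2 : ℝ)) := by
    rw [h, sub_add_cancel, show -υ.re / (1 / 2 : ℝ) = -(2 * υ.re) by ring,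
      show υ.re / (1 / 2 : ℝ) = 2 * υ.re by ring]
    ring
  rw [e]
  refine setIntegral_mono_on (integrableOn_cosTransform hυ hμ y).norm hi measurableSet_Ioi
    fun x hx => ?_
  rw [norm_mul, norm_cpow_mul_exp_neg_mul hx, ← Real.sqrt_eq_rpow, sub_re, one_re]
  refine mul_le_of_le_one_right ?_ (by rw [norm_real]; exact Real.abs_cos_le_one _)
  have := Real.rpow_nonneg (le_of_lt hx) (υ.re - 1)
  positivity

theorem re_add_mul_natCast (z c : ℂ) (k : ℕ) : (z + c * k).re = z.re + c.re * k := by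
  simp

theorem re_add_mul_natCast_pos {z c : ℂ} (hz : 0 < z.re) (hc : 0 < c.re) (k : ℕ) :
    0 < (z + c * k).re := by
  rw [re_add_mul_natCast]
  positivity

theorem summable_integral_norm_cosTransform {r s : ℕ} (hrs : r ≤ s + 1) {α : Fin r → ℂ}
    {β : Fin s → ℂ} {υ z c : ℂ} (hυ : 0 < υ.re) (hz : 0 < z.re) (hc : 0 < c.re) (y : ℝ)
    (hω : r = s + 1 → (∃ (i : Fin r) (l : ℕ), α i = -(l : ℂ)) ∨
      0 < (∑ j, β j - ∑ i, α i).re + 2 * υ.re) :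
    Summable fun k : ℕ => ∫ x in Ioi (0 : ℝ),
      ‖pochhammerQuotient α β k / (k.factorial : ℂ) *
        ((x : ℂ) ^ (υ - 1) * exp (-((z + c * k) * (√x : ℝ))) * (Real.cos (x * y) : ℝ))‖ := by
  -- This choice gives `Re (z + ck) ≥ m (k + 1)`.
  set m := min z.re c.re
  have hm : 0 < m := lt_min hz hc
  have hΓ : 0 < Real.Gamma (2 * υ.re) := Real.Gamma_pos_of_pos (by linarith)
  refine Summable.of_nonneg_of_le (fun k => integral_nonneg fun x => norm_nonneg _) (fun k => ?_)
    ((summable_pochhammerQuotient_mul_rpow hrs (by linarith) hω).mul_left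
      (2 * Real.Gamma (2 * υ.re) * m ^ (-(2 * υ.re))))
  simp only [norm_mul _ (_ * _), integral_const_mul]
  have h1 := integral_norm_cosTransform_le hυ (re_add_mul_natCast_pos hz hc k) y
  have h2 : (z + c * k).re ^ (-(2 * υ.re)) ≤ m ^ (-(2 * υ.re)) * ((k : ℝ) + 1) ^ (-(2 * υ.re)) := by
    rw [← Real.mul_rpow hm.le (by positivity), re_add_mul_natCast]
    refine Real.rpow_le_rpow_of_nonpos (by positivity) ?_ (by linarith)
    have h3 : m ≤ z.re := min_le_left _ _
    have h4 : m * k ≤ c.re * k := by gcongr; exact min_le_right _ _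
    linarith
  calc _ ≤ ‖pochhammerQuotient α β k / (k.factorial : ℂ)‖ *
        (2 * Real.Gamma (2 * υ.re) * (m ^ (-(2 * υ.re)) * ((k : ℝ) + 1) ^ (-(2 * υ.re)))) := by
        refine mul_le_mul_of_nonneg_left (h1.trans ?_) (norm_nonneg _)
        gcongr
    _ = _ := by ring

theorem nablaIntegrand_eq_tsum {r s : ℕ} (α : Fin r → ℂ) (β : Fin s → ℂ) (υ b c lam : ℂ)
    (y x : ℝ) :
    nablaIntegrand α β υ b c lam y x = ∑' k : ℕ, pochhammerQuotient α β k / (k.factorial : ℂ) *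
      ((x : ℂ) ^ (υ - 1) * exp (-((lam * b + c * k) * (√x : ℝ))) * (Real.cos (x * y) : ℝ)) := by
  -- In a field, constant factors pass through `∑'` even for a divergent series, so convergence need
  -- not be checked.
  rw [nablaIntegrand, genHypergeometric, ← tsum_mul_left, ← tsum_mul_right]
  refine tsum_congr fun k => ?_
  rw [← exp_nat_mul, show -((lam * b + c * k) * (√x : ℝ)) =
    -(b * lam * (√x : ℝ)) + k * -(c * (√x : ℝ)) by ring, exp_add]
  ring

end Series

/-! ### Substituting the Meijer values into the series -/

section SeriesMeijerG

/-- The `κ`-th power of the argument, `2^(6κ) y^(2κ) μ^(-4κ)`, is divided out: this produces `P` and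
the exponent `e`. Parameters enter through equations so that each simplified form can be matched
afterwards. -/
theorem exists_isMeijerG_four_hasSum {υ z c S : ℂ} {y : ℝ} (hυ : 0 < υ.re) (hz : 0 < z.re)
    (hc : 0 < c.re) (hy : 0 < y) {T : ℕ → ℂ}
    (hS : HasSum (fun k : ℕ => T k / (k.factorial : ℂ) * ∫ x in Set.Ioi (0 : ℝ), (x : ℂ) ^ (υ - 1) *
      exp (-((z + c * k) * (√x : ℝ))) * (Real.cos (x * y) : ℝ)) S)
    (κ : ℝ) {a : Fin 4 → ℂ} {b b' : Fin 1 → ℂ} {e P : ℂ}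
    (ha : a = ![(4 - 2 * υ) / 4 + κ, (3 - 2 * υ) / 4 + κ, (2 - 2 * υ) / 4 + κ,
      (1 - 2 * υ) / 4 + κ])
    (hb : b = ![(κ : ℂ)]) (hb' : b' = ![1 / 2 + (κ : ℂ)]) (he : e = 2 * υ - 4 * κ)
    (hP : P = 2 ^ (4 * υ - 3 / 2 - 6 * κ) * (y : ℂ) ^ (-(2 * κ) : ℂ) / Real.pi) :
    ∃ G : ℕ → ℂ,
      (∀ k : ℕ, IsMeijerG a ![] b b'
        ((Real.log (64 * y ^ 2) : ℝ) - 4 * log (z + c * k)) (G k)) ∧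
      HasSum (fun k : ℕ => P * (T k / (k.factorial * (z + c * k) ^ e) * G k)) S := by
  subst ha hb hb' he hP
  refine ⟨_, fun k => isMeijerG_four hυ (re_add_mul_natCast_pos hz hc k) hy κ, ?_⟩
  refine hS.congr_fun fun k => ?_
  set μ := z + c * k
  have hμ0 : μ ≠ 0 := fun h => by
    have := re_add_mul_natCast_pos hz hc k
    simp [μ, h] at this
  have hy0 : (y : ℂ) ≠ 0 := ofReal_ne_zero.2 hy.ne'
  have hpi : (Real.pi : ℂ) ≠ 0 := ofReal_ne_zero.2 Real.pi_ne_zero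
  have hexp : exp (κ * ((Real.log (64 * y ^ 2) : ℝ) - 4 * log μ)) =
      2 ^ (6 * κ : ℂ) * (y : ℂ) ^ (2 * κ : ℂ) * μ ^ (-(4 * κ) : ℂ) := by
    have := exp_mul_logs hy hμ0 6 2 4 κ
    norm_num at this
    exact this
  have h2 : (2 : ℂ) ^ (4 * υ - 3 / 2 - 6 * κ) * 2 ^ (3 / 2 - 4 * υ) * 2 ^ (6 * κ : ℂ) = 1 := by
    rw [← cpow_add _ _ two_ne_zero, ← cpow_add _ _ two_ne_zero]
    ring_nf
    exact cpow_zero 2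
  have h3 : (y : ℂ) ^ (-(2 * κ) : ℂ) * (y : ℂ) ^ (2 * κ : ℂ) = 1 := by
    rw [← cpow_add _ _ hy0, neg_add_cancel, cpow_zero]
  have h4 : μ ^ (2 * υ - 4 * κ) = μ ^ (2 * υ) * μ ^ (-(4 * κ) : ℂ) := by
    rw [← cpow_add _ _ hμ0, sub_eq_add_neg]
  have h5 : μ ^ (2 * υ) * μ ^ (-(4 * κ) : ℂ) ≠ 0 := by simp [cpow_eq_zero_iff, hμ0]
  rw [hexp, h4]
  generalize (∫ x in Set.Ioi (0 : ℝ), _ : ℂ) = J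
  calc _ = (2 ^ (4 * υ - 3 / 2 - 6 * κ) * 2 ^ (3 / 2 - 4 * υ) * 2 ^ (6 * κ : ℂ)) *
        ((y : ℂ) ^ (-(2 * κ) : ℂ) * (y : ℂ) ^ (2 * κ : ℂ)) * (Real.pi / Real.pi) *
        ((μ ^ (2 * υ) * μ ^ (-(4 * κ) : ℂ)) / (μ ^ (2 * υ) * μ ^ (-(4 * κ) : ℂ))) *
        (T k / k.factorial * J) := by ring
    _ = _ := by rw [h2, h3, div_self hpi, div_self h5]; ring

theorem exists_isMeijerG_eight_hasSum {υ z c S : ℂ} {y : ℝ} (hυ : 0 < υ.re) (hz : 0 < z.re)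
    (hc : 0 < c.re) (hy : 0 < y) {T : ℕ → ℂ}
    (hS : HasSum (fun k : ℕ => T k / (k.factorial : ℂ) * ∫ x in Set.Ioi (0 : ℝ), (x : ℂ) ^ (υ - 1) *
      exp (-((z + c * k) * (√x : ℝ))) * (Real.cos (x * y) : ℝ)) S) :
    ∃ G : ℕ → ℂ,
      (∀ k : ℕ, IsMeijerG
        ![(8 - 2 * υ) / 8, (7 - 2 * υ) / 8, (6 - 2 * υ) / 8, (5 - 2 * υ) / 8,
          (4 - 2 * υ) / 8, (3 - 2 * υ) / 8, (2 - 2 * υ) / 8, (1 - 2 * υ) / 8] ![]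
        ![0, 1 / 2] ![1 / 4, 3 / 4]
        ((Real.log (4 ^ 8 * y ^ 4) : ℝ) - 8 * log (z + c * k)) (G k)) ∧
      HasSum (fun k : ℕ => (2 : ℂ) ^ (6 * υ - 7 / 2) / (Real.pi : ℂ) ^ 3 *
        (T k / (k.factorial * (z + c * k) ^ (2 * υ)) * G k)) S := by
  refine ⟨_, fun k => isMeijerG_eight hυ (re_add_mul_natCast_pos hz hc k) hy, ?_⟩
  refine hS.congr_fun fun k => ?_
  set μ := z + c * k
  have hμ0 : μ ≠ 0 := fun h => by
    have := re_add_mul_natCast_pos hz hc k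
    simp [μ, h] at this
  have hpi : (Real.pi : ℂ) ^ 3 ≠ 0 := pow_ne_zero _ (ofReal_ne_zero.2 Real.pi_ne_zero)
  have h2 : (2 : ℂ) ^ (6 * υ - 7 / 2) * 2 ^ (7 / 2 - 6 * υ) = 1 := by
    rw [← cpow_add _ _ two_ne_zero, ← neg_sub, neg_add_cancel, cpow_zero]
  have h5 : μ ^ (2 * υ) ≠ 0 := by simp [cpow_eq_zero_iff, hμ0]
  generalize (∫ x in Set.Ioi (0 : ℝ), _ : ℂ) = J
  calc _ = (2 ^ (6 * υ - 7 / 2) * 2 ^ (7 / 2 - 6 * υ)) *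
        ((Real.pi : ℂ) ^ 3 / (Real.pi : ℂ) ^ 3) * (μ ^ (2 * υ) / μ ^ (2 * υ)) *
        (T k / k.factorial * J) := by ring
    _ = _ := by rw [h2, div_self hpi, div_self h5]; ring

end SeriesMeijerG

/-! ### The main theorem; the shifts are `κ = 0, -1/4, 1/2, -1/2` -/

theorem corollary2 {r s : ℕ} (hrs : r ≤ s + 1) (α : Fin r → ℂ) (β : Fin s → ℂ)
    (hβ : ∀ (j : Fin s) (l : ℕ), β j ≠ -(l : ℂ))
    (υ b c lam : ℂ) (y : ℝ)
    (hy : 0 < y) (hυ : 0 < υ.re) (hc : 0 < c.re)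
    (hlb : (0 < lam.re ∧ 0 < b.re) ∨ (lam.re < 0 ∧ b.re < 0))
    -- convergence of the integral at infinity (automatic for real `lam` and `b`)
    (hconv : 0 < (lam * b).re)
    -- convergence of the integral at zero, only for `r = s + 1` and a series that does not terminate
    (hω : r = s + 1 → (∃ (i : Fin r) (l : ℕ), α i = -(l : ℂ)) ∨
      0 < (∑ j, β j - ∑ i, α i).re + 2 * υ.re) :
    MeasureTheory.IntegrableOn (nablaIntegrand α β υ b c lam y) (Set.Ioi 0) ∧
    (∀ k : ℕ, MeasureTheory.IntegrableOn (fun x : ℝ => (x : ℂ) ^ (υ - 1) *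
      Complex.exp (-((lam * b + c * k) * (√x : ℝ))) * (Real.cos (x * y) : ℝ)) (Set.Ioi 0)) ∧
    HasSum (fun k : ℕ => pochhammerQuotient α β k / (k.factorial : ℂ) *
      ∫ x in Set.Ioi (0 : ℝ), (x : ℂ) ^ (υ - 1) *
        Complex.exp (-((lam * b + c * k) * (√x : ℝ))) * (Real.cos (x * y) : ℝ))
      (nablaC α β υ b c lam y) ∧
    (∃ G : ℕ → ℂ,
      (∀ k : ℕ, IsMeijerG
        ![(4 - 2 * υ) / 4, (3 - 2 * υ) / 4, (2 - 2 * υ) / 4, (1 - 2 * υ) / 4] ![]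
        ![0] ![1 / 2]
        ((Real.log (64 * y ^ 2) : ℝ) - 4 * Complex.log (lam * b + c * k)) (G k)) ∧
      HasSum (fun k : ℕ => (2 : ℂ) ^ (4 * υ - 3 / 2) / Real.pi *
        (pochhammerQuotient α β k / (k.factorial * (lam * b + c * k) ^ (2 * υ)) * G k))
        (nablaC α β υ b c lam y)) ∧
    (∃ G : ℕ → ℂ,
      (∀ k : ℕ, IsMeijerG
        ![(3 - 2 * υ) / 4, (2 - 2 * υ) / 4, (1 - 2 * υ) / 4, (-2 * υ) / 4] ![]
        ![-1 / 4] ![1 / 4]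
        ((Real.log (64 * y ^ 2) : ℝ) - 4 * Complex.log (lam * b + c * k)) (G k)) ∧
      HasSum (fun k : ℕ => (√y : ℝ) * (2 : ℂ) ^ (4 * υ) / Real.pi *
        (pochhammerQuotient α β k / (k.factorial * (lam * b + c * k) ^ (2 * υ + 1)) * G k))
        (nablaC α β υ b c lam y)) ∧
    (∃ G : ℕ → ℂ,
      (∀ k : ℕ, IsMeijerG
        ![(6 - 2 * υ) / 4, (5 - 2 * υ) / 4, (4 - 2 * υ) / 4, (3 - 2 * υ) / 4] ![]
        ![1 / 2] ![1]
        ((Real.log (64 * y ^ 2) : ℝ) - 4 * Complex.log (lam * b + c * k)) (G k)) ∧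
      HasSum (fun k : ℕ => (2 : ℂ) ^ (4 * υ - 9 / 2) / (Real.pi * y) *
        (pochhammerQuotient α β k / (k.factorial * (lam * b + c * k) ^ (2 * υ - 2)) * G k))
        (nablaC α β υ b c lam y)) ∧
    (∃ G : ℕ → ℂ,
      (∀ k : ℕ, IsMeijerG
        ![(2 - 2 * υ) / 4, (1 - 2 * υ) / 4, (-2 * υ) / 4, (-1 - 2 * υ) / 4] ![]
        ![-1 / 2] ![0]
        ((Real.log (64 * y ^ 2) : ℝ) - 4 * Complex.log (lam * b + c * k)) (G k)) ∧
      HasSum (fun k : ℕ => y * (2 : ℂ) ^ (4 * υ + 3 / 2) / Real.pi *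
        (pochhammerQuotient α β k / (k.factorial * (lam * b + c * k) ^ (2 * υ + 2)) * G k))
        (nablaC α β υ b c lam y)) ∧
    (∃ G : ℕ → ℂ,
      (∀ k : ℕ, IsMeijerG
        ![(8 - 2 * υ) / 8, (7 - 2 * υ) / 8, (6 - 2 * υ) / 8, (5 - 2 * υ) / 8,
          (4 - 2 * υ) / 8, (3 - 2 * υ) / 8, (2 - 2 * υ) / 8, (1 - 2 * υ) / 8] ![]
        ![0, 1 / 2] ![1 / 4, 3 / 4]
        ((Real.log (4 ^ 8 * y ^ 4) : ℝ) - 8 * Complex.log (lam * b + c * k)) (G k)) ∧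
      HasSum (fun k : ℕ => (2 : ℂ) ^ (6 * υ - 7 / 2) / (Real.pi : ℂ) ^ 3 *
        (pochhammerQuotient α β k / (k.factorial * (lam * b + c * k) ^ (2 * υ)) * G k))
        (nablaC α β υ b c lam y)) := by
  have hμ := re_add_mul_natCast_pos hconv hc
  have hint : ∀ k : ℕ, MeasureTheory.IntegrableOn (fun x : ℝ => (x : ℂ) ^ (υ - 1) *
      Complex.exp (-((lam * b + c * k) * (√x : ℝ))) * (Real.cos (x * y) : ℝ)) (Set.Ioi 0) :=
    fun k => integrableOn_cosTransform hυ (hμ k) y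
  have hF := fun k : ℕ => (hint k).const_mul (pochhammerQuotient α β k / (k.factorial : ℂ))
  have hsum := summable_integral_norm_cosTransform hrs hυ hconv hc y hω
  have hS : HasSum (fun k : ℕ => pochhammerQuotient α β k / (k.factorial : ℂ) *
      ∫ x in Set.Ioi (0 : ℝ), (x : ℂ) ^ (υ - 1) *
        Complex.exp (-((lam * b + c * k) * (√x : ℝ))) * (Real.cos (x * y) : ℝ))
      (nablaC α β υ b c lam y) := by
    have h := MeasureTheory.hasSum_integral_of_summable_integral_norm hF hsum
    simp only [← nablaIntegrand_eq_tsum, MeasureTheory.integral_const_mul] at h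
    exact h
  have hy0 : (y : ℂ) ≠ 0 := ofReal_ne_zero.2 hy.ne'
  refine ⟨?_, hint, hS, ?_, ?_, ?_, ?_, exists_isMeijerG_eight_hasSum hυ hconv hc hy hS⟩
  · have h := integrable_tsum_of_summable_integral_norm hF hsum
    simp only [← nablaIntegrand_eq_tsum] at h
    exact h
  · refine exists_isMeijerG_four_hasSum hυ hconv hc hy hS 0 ?_ ?_ ?_ ?_ ?_ <;> simp
  · refine exists_isMeijerG_four_hasSum hυ hconv hc hy hS (-1 / 4) ?_ ?_ ?_ ?_ ?_
    · push_cast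
      ring_nf
    · push_cast
      ring_nf
    · push_cast
      ring_nf
    · push_cast
      ring_nf
    · have h : ((√y : ℝ) : ℂ) = (y : ℂ) ^ (1 / 2 : ℂ) := by
        rw [Real.sqrt_eq_rpow, ofReal_cpow hy.le]
        push_cast
        rfl
      rw [h]
      push_cast
      ring_nf
  · refine exists_isMeijerG_four_hasSum hυ hconv hc hy hS (1 / 2) ?_ ?_ ?_ ?_ ?_
    · push_cast
      ring_nf
    · push_cast
      ring_nf
    · push_cast
      ring_nf
    · push_cast
      ring_nf
    · have h : (y : ℂ) ^ (-(2 * ((1 / 2 : ℝ) : ℂ))) = (y : ℂ)⁻¹ := by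
        rw [← cpow_neg_one]
        push_cast
        ring_nf
      rw [h]
      push_cast
      ring_nf
  · refine exists_isMeijerG_four_hasSum hυ hconv hc hy hS (-1 / 2) ?_ ?_ ?_ ?_ ?_
    · push_cast
      ring_nf
    · push_cast
      ring_nf
    · push_cast
      ring_nf
    · push_cast
      ring_nf
    · have h : (y : ℂ) ^ (-(2 * ((-1 / 2 : ℝ) : ℂ))) = (y : ℂ) := by
        nth_rewrite 2 [← cpow_one (y : ℂ)]
        push_cast
        ring_nf
      rw [h]
      push_cast
      ring_nf
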